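/- **Setting.** A comparison function $<_\sigma$ on $[n]$ declares, for any two distinct $u,v\in[n]$, exactly one of $u<_\sigma v$ and $v<_\sigma u$ (it need not be transitive); it is a total ordering if it is transitive. Let $\mathcal D$ be a probability distribution on the 2-subsets of $[n]$. We say that $<_\sigma$ is $\varepsilon$-far from total orderings with respect to $\mathcal D$ if, for every total ordering $<_\tau$ of $[n]$, a random pair $\{u,v\}\sim\mathcal D$ is ordered differently by $<_\sigma$ and $<_\tau$ with probability at least $\varepsilon$. A (two-sided, adaptive) distribution-free tester for total orderings on $[n]$ with distance parameter $\varepsilon>0$ is a randomized algorithm that may adaptively compare two distinct elements of its choice (receiving their order under the unknown $<_\sigma$) and draw independent samples from the unknown $\mathcal D$, and that, for all $<_\sigma$ and $\mathcal D$, accepts with probability at least $2/3$ if $<_\sigma$ is a total ordering, and rejects with probability at least $2/3$ if $<_\sigma$ is $\varepsilon$-far from total orderings with respect to $\mathcal D$. Its number of queries is the worst-case number of comparisons made plus samples drawn. **Theorem.** (Upper bound) There are absolute constants $C$ and $k$ such that for all $n\ge 2$ and all $\varepsilon>0$ there is such a tester that makes at most $C(\log n)^k\sqrt n/\varepsilon$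 queries; that is, $\tilde O(\sqrt n/\varepsilon)$ queries suffice. (Lower bound) There are absolute constants $\varepsilon_0>0$ and $c>0$ such that for all $0<\varepsilon\le\varepsilon_0$ and all $n\ge 3$, every such tester on $[n]$ with distance parameter $\varepsilon$ makes at least $c\sqrt n$ queries; that is, $\Omega(\sqrt n)$ queries are necessary. -/

import Mathlib

open scoped ENNReal

namespace TotalOrderTesting

/-- A comparison function on `n` elements: for any two distinct elements `u`, `v` exactly one of
`u < v` and `v < u` holds (in other words, a tournament). Transitivity is not required. -/
structure Comparison (n : ℕ) where
  /-- `lt u v = true` means that `u` is declared smaller than `v`. -/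
  lt : Fin n → Fin n → Bool
  lt_irrefl : ∀ u, lt u u = false
  lt_swap : ∀ u v, u ≠ v → lt v u = !lt u v

/-- The comparison function is a total ordering. -/
def Comparison.IsTotal {n : ℕ} (σ : Comparison n) : Prop :=
  IsStrictTotalOrder (Fin n) (fun u v => σ.lt u v = true)

/-- The 2-subsets of an `n`-element set. -/
abbrev Pair (n : ℕ) : Type := {e : Finset (Fin n) // e.card = 2}

/-- The pairs `{u, v}` on which two comparison functions disagree. -/
def disagreement {n : ℕ} (σ τ : Comparison n) : Set (Pair n) :=
  {e | ∃ u ∈ e.1, ∃ v ∈ e.1, σ.lt u v = true ∧ τ.lt v u = true}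

/-- The distance of `σ` and `τ` with respect to `D`: the probability that they disagree on a
random pair. -/
noncomputable def distance {n : ℕ} (D : PMF (Pair n)) (σ τ : Comparison n) : ℝ≥0∞ :=
  D.toOuterMeasure (disagreement σ τ)

/-- `σ` is `ε`-far from total orderings with respect to `D`. -/
def IsFar {n : ℕ} (D : PMF (Pair n)) (σ : Comparison n) (ε : ℝ) : Prop :=
  ∀ τ : Comparison n, τ.IsTotal → ENNReal.ofReal ε ≤ distance D σ τ

/-- A deterministic adaptive algorithm: at each step it stops and accepts (`true`) or rejects
(`false`), or compares two distinct elements of its choice, or draws a fresh sample pair. What it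
does next depends on all the answers received so far. -/
inductive Tree (n : ℕ) : Type
  | answer (b : Bool) : Tree n
  | query (u v : Fin n) (h : u ≠ v) (next : Bool → Tree n) : Tree n
  | sample (next : Pair n → Tree n) : Tree n

namespace Tree

/-- The worst-case number of comparison queries plus samples. -/
def cost {n : ℕ} : Tree n → ℕ
  | answer _ => 0
  | query _ _ _ next => 1 + max (next true).cost (next false).cost
  | sample next => 1 + Finset.univ.sup fun e => (next e).cost

/-- The law of the answer, when queries are answered by `σ` and samples are independent draws
from `D`. -/
noncomputable def run {n : ℕ} (σ : Comparison n) (D : PMF (Pair n)) : Tree n → PMF Bool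
  | answer b => PMF.pure b
  | query u v _ next => (next (σ.lt u v)).run σ D
  | sample next => D.bind fun e => (next e).run σ D

end Tree

/-- A randomized adaptive algorithm: a probability distribution over deterministic ones. -/
abbrev Algorithm (n : ℕ) : Type := PMF (Tree n)

namespace Algorithm

/-- The law of the answer of a randomized algorithm on input `(σ, D)`. -/
noncomputable def run {n : ℕ} (A : Algorithm n) (σ : Comparison n) (D : PMF (Pair n)) :
    PMF Bool :=
  PMF.bind A fun t => t.run σ D

/-- `A` never makes more than `q` queries, samples included. -/
def QueriesLE {n : ℕ} (A : Algorithm n) (q : ℕ) : Prop :=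
  ∀ t ∈ PMF.support A, t.cost ≤ q

/-- `A` is a (two-sided, adaptive, distribution-free) tester for total orderings with distance
parameter `ε`: whatever `D` is, it accepts total orderings with probability at least `2/3` and
rejects comparison functions that are `ε`-far from total orderings with probability at least
`2/3`. -/
def IsTester {n : ℕ} (A : Algorithm n) (ε : ℝ) : Prop :=
  ∀ (σ : Comparison n) (D : PMF (Pair n)),
    (σ.IsTotal → 2 / 3 ≤ A.run σ D true) ∧ (IsFar D σ ε → 2 / 3 ≤ A.run σ D false)

end Algorithm

end TotalOrderTesting

open TotalOrderTesting

/-!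
Both bounds have elementary proofs.

**Upper bound.** The tester is quicksort. The smaller endpoints of `m ≈ √n / ε` samples serve, in
the order of their arrival, as pivots: every pivot divides its bucket into the elements below and
above it, whether or not the comparison function is transitive. Then `m` more samples are drawn,
and the tester rejects if one of them has its endpoints in two different buckets that are ordered
against the direct comparison. A total ordering is never rejected.

Soundness. Let `V` be the weight of the pairs that are separated in the wrong order, let `c w` be
the weight that would be added to `V` by the pivot `w`, and let `p w` be the probability that the
next pivot is `w`. If all elements of a set `W` are used as pivots, then `V` grows by at most
`∑ w ∈ W, c w`, because refining the buckets only lowers the cost of a pivot, and the pairs that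
are still inside a bucket have weight at most `∑ w ∉ W, p w`. As sorting the buckets arbitrarily
gives a total ordering, `ε - V ≤ ∑ w, min (c w) (p w)` (`IsFar.le_sum_min`). So as long as `V` is
small, the truncated cost `min (c w) δ` of a random pivot has mean at least `ε² / (16 n)`
(`IsFar.le_sum_mul_min`), and for `δ = 12 / m` the weight `V` reaches `δ` within `m` pivots
with high probability (`IsFar.avg_pow_violation_lt`). The second batch of samples then detects it.

Cost. In any tournament a random pivot is expected to reduce the bucket of weight `b` of a fixed
element to at most `b - b² / 6` (`avg_bucketWeight_le`), since at least one of the six arrangements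
of a triple is of the form `a ≤ b ≤ c`. Hence an element is compared with `O(log m)` pivots on
average, and by Markov's inequality the run may be cut off (`Tree.trunc`). For `ε` so small that
`√n / ε ≥ n²`, when `log m` need not be `O(log n)`, all comparisons can be made instead.

**Lower bound.** The elements are arranged at random in blocks of three, and the distribution is
uniform on the pairs inside blocks. Either the elements are ordered by position, or every block is
a cyclic triangle. Unless some block has been seen completely, the two cases cannot be
distinguished: reversing the blocks of which exactly the two ends have been seen is an involution
that matches the answers (`orderedCmp_flipEnds`, `sum_leafSum_ordered_eq_cyclic`). With `q` steps a
block is seen completely only with probability `O(q² / n)`, because an element that has not been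
seen is equally likely to be in each of the remaining positions
(`sum_leafSum_not_noFullBlock_le`).
-/

namespace TotalOrderTesting

/-! ### Real-valued evaluation of algorithms -/

namespace Tree

/-- The acceptance probability of a deterministic algorithm as a real number, when the sample
pairs have the weights `d`. -/
noncomputable def acc {n : ℕ} (σ : Comparison n) (d : Pair n → ℝ) : Tree n → ℝ
  | answer b => if b then 1 else 0
  | query u v _ next => (next (σ.lt u v)).acc σ d
  | sample next => ∑ e, d e * (next e).acc σ d

/-- The expected number of queries and samples, when the sample pairs have the weights `d`. -/
noncomputable def expCost {n : ℕ} (σ : Comparison n) (d : Pair n → ℝ) : Tree n → ℝ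
  | answer _ => 0
  | query u v _ next => 1 + (next (σ.lt u v)).expCost σ d
  | sample next => 1 + ∑ e, d e * (next e).expCost σ d

/-- The algorithm that follows `t` for at most `q` steps, and accepts if `t` has not answered by
then. -/
def trunc {n : ℕ} : Tree n → ℕ → Tree n
  | answer b, _ => answer b
  | query _ _ _ _, 0 => answer true
  | query u v h next, q + 1 => query u v h fun b => (next b).trunc q
  | sample _, 0 => answer true
  | sample next, q + 1 => sample fun e => (next e).trunc q

variable {n : ℕ} {σ : Comparison n} {d : Pair n → ℝ}

theorem acc_nonneg (hd : ∀ e, 0 ≤ d e) (t : Tree n) : 0 ≤ t.acc σ d := by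
  induction t with
  | answer b => unfold acc; split_ifs <;> norm_num
  | query u v h next ih => exact ih _
  | sample next ih => exact Finset.sum_nonneg fun e _ => mul_nonneg (hd e) (ih e)

theorem acc_le_one (hd : ∀ e, 0 ≤ d e) (hd1 : ∑ e, d e = 1) (t : Tree n) : t.acc σ d ≤ 1 := by
  induction t with
  | answer b => unfold acc; split_ifs <;> norm_num
  | query u v h next ih => exact ih _
  | sample next ih =>
    calc ∑ e, d e * (next e).acc σ d ≤ ∑ e, d e :=
          Finset.sum_le_sum fun e _ => mul_le_of_le_one_right (hd e) (ih e)
      _ = 1 := hd1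

theorem expCost_nonneg (hd : ∀ e, 0 ≤ d e) (t : Tree n) : 0 ≤ t.expCost σ d := by
  induction t with
  | answer b => exact le_rfl
  | query u v h next ih => exact add_nonneg zero_le_one (ih _)
  | sample next ih =>
    exact add_nonneg zero_le_one (Finset.sum_nonneg fun e _ => mul_nonneg (hd e) (ih e))

theorem cost_trunc_le (t : Tree n) (q : ℕ) : (t.trunc q).cost ≤ q := by
  induction t generalizing q with
  | answer b => exact Nat.zero_le _
  | query u v h next ih =>
    cases q with
    | zero => exact le_rfl
    | succ q =>
      have h1 := ih true q
      have h2 := ih false q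
      simp only [trunc, cost]
      omega
  | sample next ih =>
    cases q with
    | zero => exact le_rfl
    | succ q =>
      have h1 : (Finset.univ.sup fun e => ((next e).trunc q).cost) ≤ q :=
        Finset.sup_le fun e _ => ih e q
      simp only [trunc, cost]
      omega

theorem acc_le_acc_trunc (hd : ∀ e, 0 ≤ d e) (hd1 : ∑ e, d e = 1) (t : Tree n) (q : ℕ) :
    t.acc σ d ≤ (t.trunc q).acc σ d := by
  induction t generalizing q with
  | answer b => exact le_rfl
  | query u v h next ih =>
    cases q with
    | zero => simpa [trunc, acc] using acc_le_one hd hd1 (next (σ.lt u v))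
    | succ q => exact ih _ q
  | sample next ih =>
    cases q with
    | zero => simpa [trunc, acc] using acc_le_one hd hd1 (sample next) (σ := σ)
    | succ q => exact Finset.sum_le_sum fun e _ => mul_le_mul_of_nonneg_left (ih e q) (hd e)

/-- Markov's inequality for the number of steps: truncation after `q` steps raises the acceptance
probability by at most `expCost / q`. -/
theorem acc_trunc_le (hd : ∀ e, 0 ≤ d e) (hd1 : ∑ e, d e = 1) (t : Tree n) (q : ℕ) :
    (q : ℝ) * ((t.trunc q).acc σ d - t.acc σ d) ≤ t.expCost σ d := by
  induction t generalizing q with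
  | answer b => simp [trunc, expCost]
  | query u v h next ih =>
    cases q with
    | zero => simpa using expCost_nonneg hd (query u v h next) (σ := σ)
    | succ q =>
      have h1 := ih (σ.lt u v) q
      have h2 := acc_le_one hd hd1 ((next (σ.lt u v)).trunc q) (σ := σ)
      have h3 := acc_nonneg hd (next (σ.lt u v)) (σ := σ)
      simp only [trunc, acc, expCost]
      push_cast
      linarith
  | sample next ih =>
    cases q with
    | zero => simpa using expCost_nonneg hd (sample next) (σ := σ)
    | succ q =>
      simp only [trunc, acc, expCost]
      rw [← Finset.sum_sub_distrib, Finset.mul_sum, ← hd1, ← Finset.sum_add_distrib]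
      refine Finset.sum_le_sum fun e _ => ?_
      have h1 := ih e q
      have h2 := acc_le_one hd hd1 ((next e).trunc q) (σ := σ)
      have h3 := acc_nonneg hd (next e) (σ := σ)
      have h4 : ((q : ℝ) + 1) * (((next e).trunc q).acc σ d - (next e).acc σ d)
          ≤ 1 + (next e).expCost σ d := by linarith
      have h5 := mul_le_mul_of_nonneg_left h4 (hd e)
      push_cast
      linarith

end Tree

variable {n : ℕ}

/-- The probabilities of a distribution on pairs, as real numbers. -/
noncomputable def weight (D : PMF (Pair n)) (e : Pair n) : ℝ := (D e).toReal

theorem weight_nonneg (D : PMF (Pair n)) (e : Pair n) : 0 ≤ weight D e := ENNReal.toReal_nonneg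

theorem ofReal_weight (D : PMF (Pair n)) (e : Pair n) : ENNReal.ofReal (weight D e) = D e :=
  ENNReal.ofReal_toReal (D.apply_ne_top e)

theorem sum_weight (D : PMF (Pair n)) : ∑ e, weight D e = 1 := by
  have h := D.tsum_coe
  rw [tsum_fintype] at h
  unfold weight
  rw [← ENNReal.toReal_sum fun e _ => D.apply_ne_top e, h, ENNReal.toReal_one]

theorem Tree.run_true (σ : Comparison n) (D : PMF (Pair n)) (t : Tree n) :
    t.run σ D true = ENNReal.ofReal (t.acc σ (weight D)) := by
  induction t with
  | answer b => cases b <;> simp [Tree.run, Tree.acc]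
  | query u v h next ih => exact ih _
  | sample next ih =>
    simp only [Tree.run, Tree.acc, PMF.bind_apply, tsum_fintype, ih]
    rw [ENNReal.ofReal_sum_of_nonneg fun e _ =>
      mul_nonneg (weight_nonneg D e) (Tree.acc_nonneg (weight_nonneg D) _)]
    refine Finset.sum_congr rfl fun e _ => ?_
    rw [ENNReal.ofReal_mul (weight_nonneg D e), ofReal_weight]

theorem Tree.run_false (σ : Comparison n) (D : PMF (Pair n)) (t : Tree n) :
    t.run σ D false = ENNReal.ofReal (1 - t.acc σ (weight D)) := by
  have h := (t.run σ D).tsum_coe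
  rw [tsum_bool, Tree.run_true] at h
  have h0 := Tree.acc_nonneg (weight_nonneg D) t (σ := σ)
  rw [ENNReal.ofReal_sub _ h0, ENNReal.ofReal_one, ← h,
    ENNReal.add_sub_cancel_right ENNReal.ofReal_ne_top]

theorem two_thirds_le_ofReal {x : ℝ} (hx : 2 / 3 ≤ x) : (2 / 3 : ℝ≥0∞) ≤ ENNReal.ofReal x := by
  have h : (2 / 3 : ℝ≥0∞) = ENNReal.ofReal (2 / 3) := by
    rw [ENNReal.ofReal_div_of_pos (by norm_num)]; norm_num
  rw [h]
  exact ENNReal.ofReal_le_ofReal hx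

/-- A deterministic algorithm is a tester as soon as its real acceptance probabilities are right. -/
theorem isTester_pure {ε : ℝ} (t : Tree n)
    (h1 : ∀ (σ : Comparison n) (D : PMF (Pair n)), σ.IsTotal → 2 / 3 ≤ t.acc σ (weight D))
    (h2 : ∀ (σ : Comparison n) (D : PMF (Pair n)), IsFar D σ ε → t.acc σ (weight D) ≤ 1 / 3) :
    Algorithm.IsTester (PMF.pure t : Algorithm n) ε := by
  intro σ D
  have hrun : Algorithm.run (PMF.pure t : Algorithm n) σ D = t.run σ D := PMF.pure_bind _ _
  rw [hrun, Tree.run_true, Tree.run_false]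
  exact ⟨fun h => two_thirds_le_ofReal (h1 σ D h),
    fun h => two_thirds_le_ofReal (by linarith [h2 σ D h])⟩

theorem queriesLE_pure {q : ℕ} {t : Tree n} (h : t.cost ≤ q) :
    Algorithm.QueriesLE (PMF.pure t : Algorithm n) q := by
  intro s hs
  rw [PMF.support_pure, Set.mem_singleton_iff] at hs
  rwa [hs]

/-! ### Endpoints of a pair -/

/-- The smaller endpoint of a pair, in the numerical order of `Fin n`. -/
def fstEnd (e : Pair n) : Fin n :=
  e.1.min' (Finset.card_pos.1 (by rw [e.2]; norm_num))

/-- The larger endpoint of a pair, in the numerical order of `Fin n`. -/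
def sndEnd (e : Pair n) : Fin n :=
  e.1.max' (Finset.card_pos.1 (by rw [e.2]; norm_num))

theorem fstEnd_mem (e : Pair n) : fstEnd e ∈ e.1 := Finset.min'_mem _ _

theorem sndEnd_mem (e : Pair n) : sndEnd e ∈ e.1 := Finset.max'_mem _ _

theorem fstEnd_ne_sndEnd (e : Pair n) : fstEnd e ≠ sndEnd e :=
  (Finset.min'_lt_max'_of_card _ (by rw [e.2]; norm_num)).ne

theorem mem_pair_iff (e : Pair n) (x : Fin n) : x ∈ e.1 ↔ x = fstEnd e ∨ x = sndEnd e := by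
  have hsub : ({fstEnd e, sndEnd e} : Finset (Fin n)) ⊆ e.1 := by
    intro y hy
    rcases Finset.mem_insert.1 hy with rfl | hy
    · exact fstEnd_mem e
    · rw [Finset.mem_singleton.1 hy]; exact sndEnd_mem e
  have h := Finset.eq_of_subset_of_card_le hsub
    (by rw [e.2, Finset.card_pair (fstEnd_ne_sndEnd e)])
  rw [← h, Finset.mem_insert, Finset.mem_singleton]

theorem mem_disagreement_iff (σ τ : Comparison n) (e : Pair n) :
    e ∈ disagreement σ τ ↔
      (σ.lt (fstEnd e) (sndEnd e) = true ∧ τ.lt (sndEnd e) (fstEnd e) = true) ∨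
      (σ.lt (sndEnd e) (fstEnd e) = true ∧ τ.lt (fstEnd e) (sndEnd e) = true) := by
  constructor
  · rintro ⟨u, hu, v, hv, h1, h2⟩
    rcases (mem_pair_iff e u).1 hu with rfl | rfl <;> rcases (mem_pair_iff e v).1 hv with rfl | rfl
    · rw [σ.lt_irrefl] at h1; cases h1
    · exact Or.inl ⟨h1, h2⟩
    · exact Or.inr ⟨h1, h2⟩
    · rw [σ.lt_irrefl] at h1; cases h1
  · rintro (⟨h1, h2⟩ | ⟨h1, h2⟩)
    · exact ⟨_, fstEnd_mem e, _, sndEnd_mem e, h1, h2⟩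
    · exact ⟨_, sndEnd_mem e, _, fstEnd_mem e, h1, h2⟩

open Classical in
theorem distance_eq (D : PMF (Pair n)) (σ τ : Comparison n) :
    distance D σ τ
      = ENNReal.ofReal (∑ e, if e ∈ disagreement σ τ then weight D e else 0) := by
  rw [distance, PMF.toOuterMeasure_apply, tsum_fintype, ENNReal.ofReal_sum_of_nonneg]
  · refine Finset.sum_congr rfl fun e _ => ?_
    by_cases h : e ∈ disagreement σ τ <;> simp [h, ofReal_weight]
  · intro e _
    split_ifs
    · exact weight_nonneg D e
    · exact le_rfl

/-! ### Pivot steps -/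

/-- One step of quicksort. Elements with the same rank `r` form a bucket; the pivot `w` divides its
bucket into the elements below `w`, `w` itself, and the elements above `w`, and all ranks are
multiplied by `3` to make room. -/
def pivotStep (σ : Comparison n) (r : Fin n → ℕ) (w v : Fin n) : ℕ :=
  if r v = r w then (if v = w then 3 * r v + 1 else if σ.lt v w then 3 * r v else 3 * r v + 2)
  else 3 * r v + 1

/-- The ranks after the pivots in the list have been used, the last one first. -/
def rank (σ : Comparison n) : List (Fin n) → Fin n → ℕ
  | [] => fun _ => 0
  | w :: ws => pivotStep σ (rank σ ws) w

theorem pivotStep_lt {σ : Comparison n} {r : Fin n → ℕ} {u v : Fin n} (h : r u < r v)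
    (w : Fin n) : pivotStep σ r w u < pivotStep σ r w v := by
  unfold pivotStep
  split_ifs <;> omega

theorem pivotStep_le_of_lt {σ : Comparison n} {r : Fin n → ℕ} {u v w : Fin n}
    (h : pivotStep σ r w u < pivotStep σ r w v) : r u ≤ r v := by
  by_contra h'
  exact absurd (pivotStep_lt (σ := σ) (not_le.1 h') w) (by omega)

theorem eq_of_pivotStep_eq {σ : Comparison n} {r : Fin n → ℕ} {u v w : Fin n}
    (h : pivotStep σ r w u = pivotStep σ r w v) : r u = r v := by
  rcases lt_trichotomy (r u) (r v) with h' | h' | h'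
  · exact absurd h (pivotStep_lt h' w).ne
  · exact h'
  · exact absurd h (pivotStep_lt h' w).ne'

/-- A pivot is alone in its bucket afterwards. -/
theorem pivotStep_eq_pivot {σ : Comparison n} {r : Fin n → ℕ} {v w : Fin n}
    (h : pivotStep σ r w v = pivotStep σ r w w) : v = w := by
  have h0 := eq_of_pivotStep_eq h
  unfold pivotStep at h
  by_contra hv
  simp only [h0, if_true, hv, if_false] at h
  split_ifs at h <;> omega

theorem rank_append_eq {σ : Comparison n} (W ws : List (Fin n)) {u v : Fin n}
    (h : rank σ (W ++ ws) u = rank σ (W ++ ws) v) : rank σ ws u = rank σ ws v := by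
  induction W with
  | nil => exact h
  | cons w W ih => exact ih (eq_of_pivotStep_eq h)

theorem eq_of_rank_eq {σ : Comparison n} {ws : List (Fin n)} {u v : Fin n} (hu : u ∈ ws)
    (h : rank σ ws v = rank σ ws u) : v = u := by
  induction ws with
  | nil => cases hu
  | cons w ws ih =>
    rcases List.mem_cons.1 hu with rfl | hu
    · exact pivotStep_eq_pivot h
    · exact ih hu (eq_of_pivotStep_eq h)

/-- For a total ordering, quicksort never contradicts the ordering. -/
theorem rank_le_of_lt {σ : Comparison n} (hσ : σ.IsTotal) (ws : List (Fin n)) {u v : Fin n}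
    (h : σ.lt u v = true) : rank σ ws u ≤ rank σ ws v := by
  have htr : ∀ {a b c}, σ.lt a b = true → σ.lt b c = true → σ.lt a c = true :=
    fun h1 h2 => hσ.toIsStrictOrder.toIsTrans.trans _ _ _ h1 h2
  have hsw : ∀ {a b}, a ≠ b → σ.lt b a = !σ.lt a b := fun h => σ.lt_swap _ _ h
  induction ws with
  | nil => exact le_rfl
  | cons w ws ih =>
    rcases ih.lt_or_eq with h1 | h1
    · exact (pivotStep_lt h1 w).le
    · show pivotStep σ _ w u ≤ pivotStep σ _ w v
      unfold pivotStep
      rw [h1]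
      by_cases hw : rank σ ws v = rank σ ws w
      swap
      · simp [hw]
      simp only [hw, if_true]
      by_cases huw : u = w
      · subst huw
        have hvu : v ≠ u := by
          rintro rfl; rw [σ.lt_irrefl] at h; cases h
        have : σ.lt v u = false := by rw [hsw hvu.symm, h]; rfl
        simp [hvu, this]
      by_cases hvw : v = w
      · subst hvw
        simp [huw, h]
      by_cases h2 : σ.lt v w = true
      · simp [huw, hvw, h2, htr h h2]
      · cases h3 : σ.lt u w <;> simp [huw, hvw, h2]

/-! ### Violated pairs -/

/-- The ranks separate `u` and `v` in the wrong order. -/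
def Misplaced (σ : Comparison n) (r : Fin n → ℕ) (u v : Fin n) : Prop :=
  r u < r v ∧ σ.lt v u = true

/-- The ranks separate the endpoints of `e` in the wrong order. -/
def Violated (σ : Comparison n) (r : Fin n → ℕ) (e : Pair n) : Prop :=
  Misplaced σ r (fstEnd e) (sndEnd e) ∨ Misplaced σ r (sndEnd e) (fstEnd e)

open Classical in
/-- The weight of the pairs that the ranks separate in the wrong order. -/
noncomputable def violation (σ : Comparison n) (d : Pair n → ℝ) (r : Fin n → ℕ) : ℝ :=
  ∑ e, if Violated σ r e then d e else 0

open Classical in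
/-- The weight of the pairs whose smaller endpoint is `w`. -/
noncomputable def endWeight (d : Pair n → ℝ) (w : Fin n) : ℝ :=
  ∑ e, if fstEnd e = w then d e else 0

theorem endWeight_nonneg {d : Pair n → ℝ} (hd : ∀ e, 0 ≤ d e) (w : Fin n) :
    0 ≤ endWeight d w :=
  Finset.sum_nonneg fun e _ => by
    split_ifs
    · exact hd e
    · exact le_rfl

theorem sum_mul_fstEnd (d : Pair n → ℝ) (g : Fin n → ℝ) :
    ∑ e, d e * g (fstEnd e) = ∑ w, endWeight d w * g w := by
  classical
  unfold endWeight
  simp_rw [Finset.sum_mul]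
  rw [Finset.sum_comm]
  refine Finset.sum_congr rfl fun e _ => ?_
  simp [ite_mul]

theorem sum_endWeight (d : Pair n → ℝ) : ∑ w, endWeight d w = ∑ e, d e := by
  simpa using (sum_mul_fstEnd d fun _ => 1).symm

theorem Misplaced.after_pivotStep {σ : Comparison n} {r : Fin n → ℕ} {u v : Fin n}
    (h : Misplaced σ r u v) (w : Fin n) : Misplaced σ (pivotStep σ r w) u v :=
  ⟨pivotStep_lt h.1 w, h.2⟩

theorem Violated.after_pivotStep {σ : Comparison n} {r : Fin n → ℕ} {e : Pair n}
    (h : Violated σ r e) (w : Fin n) : Violated σ (pivotStep σ r w) e :=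
  h.imp (fun h => h.after_pivotStep w) fun h => h.after_pivotStep w

theorem violation_nonneg {σ : Comparison n} {d : Pair n → ℝ} (hd : ∀ e, 0 ≤ d e)
    (r : Fin n → ℕ) : 0 ≤ violation σ d r :=
  Finset.sum_nonneg fun e _ => by
    split_ifs
    · exact hd e
    · exact le_rfl

theorem violation_le_one {σ : Comparison n} {d : Pair n → ℝ} (hd : ∀ e, 0 ≤ d e)
    (hd1 : ∑ e, d e = 1) (r : Fin n → ℕ) : violation σ d r ≤ 1 := by
  rw [← hd1]
  refine Finset.sum_le_sum fun e _ => ?_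
  split_ifs
  · exact le_rfl
  · exact hd e

theorem violation_eq_zero {σ : Comparison n} (hσ : σ.IsTotal) (d : Pair n → ℝ)
    (ws : List (Fin n)) : violation σ d (rank σ ws) = 0 := by
  refine Finset.sum_eq_zero fun e _ => if_neg ?_
  rintro (⟨h1, h2⟩ | ⟨h1, h2⟩)
  · exact absurd (rank_le_of_lt hσ ws h2) (by omega)
  · exact absurd (rank_le_of_lt hσ ws h2) (by omega)

/-- The weight of the pairs that become violated when `w` is used as a pivot. -/
noncomputable def pivotLoss (σ : Comparison n) (d : Pair n → ℝ) (r : Fin n → ℕ) (w : Fin n) : ℝ :=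
  violation σ d (pivotStep σ r w) - violation σ d r

open Classical in
theorem pivotLoss_eq (σ : Comparison n) (d : Pair n → ℝ) (r : Fin n → ℕ) (w : Fin n) :
    pivotLoss σ d r w
      = ∑ e, if Violated σ (pivotStep σ r w) e ∧ ¬ Violated σ r e then d e else 0 := by
  unfold pivotLoss violation
  rw [← Finset.sum_sub_distrib]
  refine Finset.sum_congr rfl fun e _ => ?_
  by_cases h : Violated σ r e
  · simp [h, h.after_pivotStep w]
  · simp [h]

theorem pivotLoss_nonneg {σ : Comparison n} {d : Pair n → ℝ} (hd : ∀ e, 0 ≤ d e)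
    (r : Fin n → ℕ) (w : Fin n) : 0 ≤ pivotLoss σ d r w := by
  classical
  rw [pivotLoss_eq]
  exact Finset.sum_nonneg fun e _ => by
    split_ifs
    · exact hd e
    · exact le_rfl

/-- A pair becomes misplaced at a pivot of its own bucket, and in a coarser bucketing the same
pivot would have misplaced it too. -/
theorem Misplaced.of_finer {σ : Comparison n} {r r' : Fin n → ℕ}
    (hr : ∀ u v, r' u = r' v → r u = r v) {u v w : Fin n}
    (h : Misplaced σ (pivotStep σ r' w) u v) (h' : ¬ Misplaced σ r' u v) :
    Misplaced σ (pivotStep σ r w) u v ∧ r u = r v := by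
  have h1 : r' u = r' v := by
    refine le_antisymm (pivotStep_le_of_lt h.1) (not_lt.1 fun hlt => h' ⟨hlt, h.2⟩)
  have h2 : r' v = r' w := by
    by_contra hne
    have := h.1
    unfold pivotStep at this
    rw [h1] at this
    simp [hne] at this
  have h3 := hr u v h1
  have h4 := hr v w h2
  refine ⟨⟨?_, h.2⟩, h3⟩
  have h5 := h.1
  unfold pivotStep at h5 ⊢
  rw [h1] at h5
  rw [h3]
  simp only [h2, if_true] at h5
  simp only [h4, if_true]
  split_ifs at h5 ⊢ <;> omega

theorem pivotLoss_anti {σ : Comparison n} {d : Pair n → ℝ} (hd : ∀ e, 0 ≤ d e)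
    {r r' : Fin n → ℕ} (hr : ∀ u v, r' u = r' v → r u = r v) (w : Fin n) :
    pivotLoss σ d r' w ≤ pivotLoss σ d r w := by
  classical
  rw [pivotLoss_eq, pivotLoss_eq]
  refine Finset.sum_le_sum fun e _ => ?_
  by_cases h : Violated σ (pivotStep σ r' w) e ∧ ¬ Violated σ r' e
  · have h2 : Violated σ (pivotStep σ r w) e ∧ ¬ Violated σ r e := by
      obtain ⟨h1, h2⟩ := h
      rcases h1 with h1 | h1
      · obtain ⟨h3, h4⟩ := h1.of_finer hr fun h => h2 (Or.inl h)
        refine ⟨Or.inl h3, ?_⟩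
        rintro (⟨h5, -⟩ | ⟨h5, -⟩) <;> omega
      · obtain ⟨h3, h4⟩ := h1.of_finer hr fun h => h2 (Or.inr h)
        refine ⟨Or.inr h3, ?_⟩
        rintro (⟨h5, -⟩ | ⟨h5, -⟩) <;> omega
    rw [if_pos h, if_pos h2]
  · rw [if_neg h]
    split_ifs
    · exact hd e
    · exact le_rfl

theorem violation_append_le {σ : Comparison n} {d : Pair n → ℝ} (hd : ∀ e, 0 ≤ d e)
    (W ws : List (Fin n)) :
    violation σ d (rank σ (W ++ ws))
      ≤ violation σ d (rank σ ws) + (W.map (pivotLoss σ d (rank σ ws))).sum := by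
  induction W with
  | nil => simp
  | cons w W ih =>
    have h := pivotLoss_anti (σ := σ) hd (r := rank σ ws) (r' := rank σ (W ++ ws))
      (fun u v => rank_append_eq W ws) w
    have h' : violation σ d (rank σ (w :: W ++ ws))
      = violation σ d (rank σ (W ++ ws)) + pivotLoss σ d (rank σ (W ++ ws)) w := by
      unfold pivotLoss
      rw [List.cons_append, rank]
      ring
    rw [h', List.map_cons, List.sum_cons]
    linarith

/-! ### Far comparison functions -/

/-- The total ordering by rank, with ties broken by the numerical order of `Fin n`. -/
def rankOrder (r : Fin n → ℕ) : Comparison n where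
  lt u v := decide (r u < r v ∨ (r u = r v ∧ u < v))
  lt_irrefl u := by simp
  lt_swap u v h := by
    rcases lt_trichotomy (r u) (r v) with h1 | h1 | h1
    · simp [h1, h1.ne', h1.le]
    · rcases lt_or_gt_of_ne h with h2 | h2
      · simp [h1, h2, h2.le]
      · simp [h1, h2, h2.le]
    · simp [h1, h1.ne', h1.le]

theorem rankOrder_isTotal (r : Fin n → ℕ) : (rankOrder r).IsTotal := by
  unfold Comparison.IsTotal
  have h1 : ∀ u v, (rankOrder r).lt u v = true ↔ (r u < r v ∨ (r u = r v ∧ u < v)) :=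
    fun u v => by simp [rankOrder]
  simp_rw [h1]
  exact
    { trichotomous := fun a b h1 h2 => by omega
      irrefl := fun a h => by omega
      trans := fun a b c h1 h2 => by omega }

open Classical in
/-- If `σ` is far from total orderings, then the pairs violated by a ranking and those inside its
buckets together have weight at least `ε`: sorting the buckets arbitrarily yields a total
ordering. -/
theorem IsFar.le_violation_add {D : PMF (Pair n)} {σ : Comparison n} {ε : ℝ} (h : IsFar D σ ε)
    (r : Fin n → ℕ) :
    ε ≤ violation σ (weight D) r
      + ∑ e, if r (fstEnd e) = r (sndEnd e) then weight D e else 0 := by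
  have h1 := h (rankOrder r) (rankOrder_isTotal r)
  have hnn : ∀ (P : Prop) [Decidable P] (e : Pair n), 0 ≤ if P then weight D e else 0 := by
    intro P _ e
    split_ifs
    · exact weight_nonneg D e
    · exact le_rfl
  rw [distance_eq, ENNReal.ofReal_le_ofReal_iff (Finset.sum_nonneg fun e _ => hnn _ e)] at h1
  refine h1.trans ?_
  unfold violation
  rw [← Finset.sum_add_distrib]
  refine Finset.sum_le_sum fun e _ => ?_
  by_cases he : e ∈ disagreement σ (rankOrder r)
  · rw [if_pos he]
    rw [mem_disagreement_iff] at he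
    by_cases hr : r (fstEnd e) = r (sndEnd e)
    · rw [if_pos hr]
      have := hnn (Violated σ r e) e
      linarith
    · have hv : Violated σ r e := by
        simp only [rankOrder, decide_eq_true_eq] at he
        rcases he with ⟨h2, h3⟩ | ⟨h2, h3⟩
        · exact Or.inr ⟨by omega, h2⟩
        · exact Or.inl ⟨by omega, h2⟩
      rw [if_pos hv]
      linarith [hnn (r (fstEnd e) = r (sndEnd e)) e]
  · rw [if_neg he]
    exact add_nonneg (hnn _ e) (hnn _ e)

/-- The inequality behind the soundness of quicksort: even when the cost of every pivot is truncated
at its probability, the costs add up to at least `ε` minus the weight violated already. -/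
theorem IsFar.le_sum_min {D : PMF (Pair n)} {σ : Comparison n} {ε : ℝ} (h : IsFar D σ ε)
    (ws : List (Fin n)) :
    ε - violation σ (weight D) (rank σ ws)
      ≤ ∑ w, min (pivotLoss σ (weight D) (rank σ ws) w) (endWeight (weight D) w) := by
  classical
  set c := pivotLoss σ (weight D) (rank σ ws) with hc
  set p := endWeight (weight D) with hp
  -- The pivots that cost less than they weigh are all used; a pair that they leave unseparated
  -- has its smaller endpoint among the others.
  set W : Finset (Fin n) := Finset.univ.filter fun w => c w ≤ p w with hW
  have h1 := h.le_violation_add (rank σ (W.toList ++ ws))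
  have h2 := violation_append_le (σ := σ) (weight_nonneg D) W.toList ws
  rw [Finset.sum_map_toList] at h2
  have h3 : (∑ e, if rank σ (W.toList ++ ws) (fstEnd e) = rank σ (W.toList ++ ws) (sndEnd e)
      then weight D e else 0) ≤ ∑ w, p w * if w ∈ W then 0 else 1 := by
    rw [hp, ← sum_mul_fstEnd]
    refine Finset.sum_le_sum fun e _ => ?_
    by_cases hr : rank σ (W.toList ++ ws) (fstEnd e) = rank σ (W.toList ++ ws) (sndEnd e)
    · have : fstEnd e ∉ W := fun hm => fstEnd_ne_sndEnd e
        (eq_of_rank_eq (List.mem_append_left _ (Finset.mem_toList.2 hm)) hr.symm).symm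
      simp [hr, this]
    · rw [if_neg hr]
      refine mul_nonneg (weight_nonneg D e) ?_
      split_ifs <;> norm_num
  have h4 : ∑ w, min (c w) (p w) = ∑ w ∈ W, c w + ∑ w, p w * if w ∈ W then 0 else 1 := by
    rw [hW, Finset.sum_filter, ← Finset.sum_add_distrib]
    refine Finset.sum_congr rfl fun w _ => ?_
    by_cases hw : c w ≤ p w
    · simp [hw]
    · simp [hw, (not_le.1 hw).le]
  rw [h4]
  linarith

/-- As long as little is violated, the expected violation added by a random pivot, truncated at
`δ`, is at least `ε² / (16 n)`. -/
theorem IsFar.le_sum_mul_min {D : PMF (Pair n)} {σ : Comparison n} {ε δ : ℝ} (h : IsFar D σ ε)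
    (hn : 0 < n) (hε : 0 < ε) (hδ : ε / (4 * n) ≤ δ) {ws : List (Fin n)}
    (hV : violation σ (weight D) (rank σ ws) ≤ ε / 2) :
    ε ^ 2 / (16 * n) ≤
      ∑ w, endWeight (weight D) w * min (pivotLoss σ (weight D) (rank σ ws) w) δ := by
  have hn' : (0 : ℝ) < n := Nat.cast_pos.2 hn
  set c := pivotLoss σ (weight D) (rank σ ws) with hc
  set p := endWeight (weight D) with hp
  set θ := ε / (4 * n) with hθ
  have hθ0 : 0 < θ := by positivity
  have h1 := h.le_sum_min ws
  have h2 : ∀ w, θ * (min (c w) (p w) - θ) ≤ p w * min (c w) δ := by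
    intro w
    have hc0 : 0 ≤ c w := pivotLoss_nonneg (weight_nonneg D) _ w
    have hp0 : 0 ≤ p w := endWeight_nonneg (weight_nonneg D) w
    have hm : 0 ≤ min (c w) δ := le_min hc0 (hθ0.le.trans hδ)
    rcases le_total (min (c w) (p w)) θ with h3 | h3
    · have : θ * (min (c w) (p w) - θ) ≤ 0 :=
        mul_nonpos_of_nonneg_of_nonpos hθ0.le (by linarith)
      exact this.trans (mul_nonneg hp0 hm)
    · have h4 : θ ≤ min (c w) δ := le_min (h3.trans (min_le_left _ _)) hδ
      calc θ * (min (c w) (p w) - θ) ≤ θ * p w :=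
            mul_le_mul_of_nonneg_left (by linarith [min_le_right (c w) (p w)]) hθ0.le
        _ = p w * θ := mul_comm _ _
        _ ≤ p w * min (c w) δ := mul_le_mul_of_nonneg_left h4 hp0
  calc ε ^ 2 / (16 * n) = θ * (ε / 2 - n * θ) := by rw [hθ]; field_simp; ring
    _ ≤ θ * (∑ w, min (c w) (p w) - n * θ) :=
        mul_le_mul_of_nonneg_left (by linarith) hθ0.le
    _ = ∑ w, θ * (min (c w) (p w) - θ) := by
        rw [← Finset.mul_sum, Finset.sum_sub_distrib]; simp
    _ ≤ _ := Finset.sum_le_sum fun w _ => h2 w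

/-! ### Averaging over random pivots -/

/-- The expectation of a function of the list of pivots after one more pivot with law `p`. -/
noncomputable def avg (p : Fin n → ℝ) : Module.End ℝ (List (Fin n) → ℝ) where
  toFun f ws := ∑ w, p w * f (w :: ws)
  map_add' f g := by
    ext ws
    simp [mul_add, Finset.sum_add_distrib]
  map_smul' a f := by
    ext ws
    simp [Finset.mul_sum, mul_left_comm]

theorem avg_apply (p : Fin n → ℝ) (f : List (Fin n) → ℝ) (ws : List (Fin n)) :
    avg p f ws = ∑ w, p w * f (w :: ws) := rfl

theorem avg_pow_succ_apply (p : Fin n → ℝ) (k : ℕ) (f : List (Fin n) → ℝ) :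
    (avg p ^ (k + 1)) f = (avg p ^ k) (avg p f) := by
  rw [pow_succ]; rfl

theorem avg_pow_succ_apply' (p : Fin n → ℝ) (k : ℕ) (f : List (Fin n) → ℝ) :
    (avg p ^ (k + 1)) f = avg p ((avg p ^ k) f) := by
  rw [pow_succ']; rfl

theorem avg_pow_mono {p : Fin n → ℝ} (hp : ∀ w, 0 ≤ p w) (k : ℕ) {f g : List (Fin n) → ℝ} (h : ∀ ws, f ws ≤ g ws)
    (ws : List (Fin n)) : (avg p ^ k) f ws ≤ (avg p ^ k) g ws := by
  induction k generalizing ws with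
  | zero => exact h ws
  | succ k ih =>
    rw [avg_pow_succ_apply', avg_pow_succ_apply', avg_apply, avg_apply]
    exact Finset.sum_le_sum fun w _ => mul_le_mul_of_nonneg_left (ih _) (hp w)

theorem avg_pow_nonneg {p : Fin n → ℝ} (hp : ∀ w, 0 ≤ p w) (k : ℕ) {f : List (Fin n) → ℝ} (h : ∀ ws, 0 ≤ f ws)
    (ws : List (Fin n)) : 0 ≤ (avg p ^ k) f ws := by
  simpa using avg_pow_mono hp k (f := 0) (g := f) h ws

theorem avg_pow_const {p : Fin n → ℝ} (hp1 : ∑ w, p w = 1) (k : ℕ) (a : ℝ) (ws : List (Fin n)) :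
    (avg p ^ k) (fun _ => a) ws = a := by
  induction k generalizing ws with
  | zero => rfl
  | succ k ih =>
    rw [avg_pow_succ_apply', avg_apply]
    simp_rw [ih]
    rw [← Finset.sum_mul, hp1, one_mul]

theorem sq_avg_pow_le {p : Fin n → ℝ} (hp : ∀ w, 0 ≤ p w) 
    (hp1 : ∑ w, p w = 1) (k : ℕ) (f : List (Fin n) → ℝ)
    (ws : List (Fin n)) : ((avg p ^ k) f ws) ^ 2 ≤ (avg p ^ k) (fun ws => f ws ^ 2) ws := by
  induction k generalizing ws with
  | zero => exact le_rfl
  | succ k ih =>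
    rw [avg_pow_succ_apply', avg_pow_succ_apply', avg_apply, avg_apply]
    calc (∑ w, p w * (avg p ^ k) f (w :: ws)) ^ 2
        ≤ ∑ w, p w * ((avg p ^ k) f (w :: ws)) ^ 2 :=
          by
            simpa using (even_two.convexOn_pow (𝕜 := ℝ)).map_sum_le (t := Finset.univ) (w := p)
              (p := fun w => (avg p ^ k) f (w :: ws)) (fun w _ => hp w) hp1
              (fun _ _ => Set.mem_univ _)
      _ ≤ _ := Finset.sum_le_sum fun w _ => mul_le_mul_of_nonneg_left (ih _) (hp w)

theorem avg_pow_sum (p : Fin n → ℝ) (k : ℕ) {ι : Type*} (s : Finset ι) (a : ι → ℝ)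
    (f : ι → List (Fin n) → ℝ) (ws : List (Fin n)) :
    (avg p ^ k) (fun ws => ∑ i ∈ s, a i * f i ws) ws = ∑ i ∈ s, a i * (avg p ^ k) (f i) ws := by
  have h : (fun ws => ∑ i ∈ s, a i * f i ws) = ∑ i ∈ s, a i • f i := by
    ext ws
    simp
  rw [h, map_sum]
  simp

/-! ### The decay of buckets -/

open Classical in
/-- The weight of the other elements in the bucket of `x`. -/
noncomputable def bucketWeight (σ : Comparison n) (p : Fin n → ℝ) (x : Fin n)
    (ws : List (Fin n)) : ℝ :=
  ∑ w, if rank σ ws x = rank σ ws w ∧ x ≠ w then p w else 0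

/-- In any tournament every triple can be arranged as `a ≤ b ≤ c`, that is `a < b < c` up to
repetitions and regardless of the order of `a` and `c`; so a random triple is arranged so with
probability at least `1 / 6`. -/
theorem cube_sum_le (σ : Comparison n) {q : Fin n → ℝ} (hq : ∀ w, 0 ≤ q w) :
    (∑ w, q w) ^ 3 ≤ 6 * ∑ b, q b *
      ((∑ a, if a = b ∨ σ.lt a b = true then q a else 0) *
        (∑ c, if c = b ∨ σ.lt b c = true then q c else 0)) := by
  set le : Fin n → Fin n → ℝ := fun a b => if a = b ∨ σ.lt a b = true then 1 else 0 with hle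
  set F : Fin n → Fin n → Fin n → ℝ := fun a b c => q a * q b * q c * (le a b * le b c) with hF
  have h1 : ∑ b, q b * ((∑ a, if a = b ∨ σ.lt a b = true then q a else 0) *
        (∑ c, if c = b ∨ σ.lt b c = true then q c else 0)) = ∑ a, ∑ b, ∑ c, F a b c := by
    rw [Finset.sum_comm]
    refine Finset.sum_congr rfl fun b _ => ?_
    rw [Finset.sum_mul_sum, Finset.mul_sum]
    refine Finset.sum_congr rfl fun a _ => ?_
    rw [Finset.mul_sum]
    refine Finset.sum_congr rfl fun c _ => ?_
    simp only [hF, hle, eq_comm (a := c)]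
    split_ifs <;> ring
  have h2 : (∑ w, q w) ^ 3 = ∑ a, ∑ b, ∑ c, q a * q b * q c := by
    rw [pow_three, Finset.sum_mul_sum, Finset.sum_mul_sum]
    refine Finset.sum_congr rfl fun a _ => ?_
    refine Finset.sum_congr rfl fun b _ => ?_
    rw [Finset.mul_sum]
    exact Finset.sum_congr rfl fun c _ => by ring
  have swap12 : ∀ G : Fin n → Fin n → Fin n → ℝ,
      ∑ a, ∑ b, ∑ c, G a b c = ∑ a, ∑ b, ∑ c, G b a c := fun G => Finset.sum_comm
  have swap23 : ∀ G : Fin n → Fin n → Fin n → ℝ,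
      ∑ a, ∑ b, ∑ c, G a b c = ∑ a, ∑ b, ∑ c, G a c b :=
    fun G => Finset.sum_congr rfl fun a _ => Finset.sum_comm
  have e1 := swap12 F
  have e2 := swap23 F
  have e3 := swap23 fun a b c => F b a c
  have e4 := swap12 fun a b c => F a c b
  have e5 := swap23 fun a b c => F b c a
  have h3 : ∑ a, ∑ b, ∑ c, q a * q b * q c ≤
      ∑ a, ∑ b, ∑ c, (F a b c + F b a c + F a c b + F c a b + F b c a + F c b a) := by
    refine Finset.sum_le_sum fun a _ => Finset.sum_le_sum fun b _ => Finset.sum_le_sum fun c _ => ?_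
    have key : 1 ≤ le a b * le b c + le b a * le a c + le a c * le c b + le c a * le a b
        + le b c * le c a + le c b * le b a := by
      have hsw : ∀ x y, le x y = 1 ∨ le y x = 1 := by
        intro x y
        by_cases hxy : x = y
        · simp [hle, hxy]
        · have := σ.lt_swap x y hxy
          cases h : σ.lt x y <;> simp [hle, h, this]
      have h0 : ∀ x y, 0 ≤ le x y := by
        intro x y
        simp only [hle]
        split_ifs <;> norm_num
      have hnn := fun x y z w => mul_nonneg (h0 x y) (h0 z w)
      have n1 := hnn a b b c
      have n2 := hnn b a a c
      have n3 := hnn a c c b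
      have n4 := hnn c a a b
      have n5 := hnn b c c a
      have n6 := hnn c b b a
      rcases hsw a b with hab | hab <;> rcases hsw b c with hbc | hbc <;>
        rcases hsw a c with hac | hac <;> 
            simp only [hab, hbc, hac, one_mul, mul_one] at n1 n2 n3 n4 n5 n6 ⊢ <;> linarith
    have hq3 : 0 ≤ q a * q b * q c := mul_nonneg (mul_nonneg (hq a) (hq b)) (hq c)
    calc q a * q b * q c ≤ q a * q b * q c * (le a b * le b c + le b a * le a c + le a c * le c b
          + le c a * le a b + le b c * le c a + le c b * le b a) :=
          le_mul_of_one_le_right hq3 key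
      _ = _ := by simp only [hF]; ring
  rw [h1, h2]
  refine h3.trans ?_
  simp only [Finset.sum_add_distrib]
  linarith

theorem bucketWeight_nonneg (σ : Comparison n) {p : Fin n → ℝ} (hp : ∀ w, 0 ≤ p w) (x : Fin n)
    (ws : List (Fin n)) : 0 ≤ bucketWeight σ p x ws :=
  Finset.sum_nonneg fun w _ => by
    split_ifs
    · exact hp w
    · exact le_rfl

theorem bucketWeight_cons_le (σ : Comparison n) {p : Fin n → ℝ} (hp : ∀ w, 0 ≤ p w) (x w : Fin n)
    (ws : List (Fin n)) : bucketWeight σ p x (w :: ws) ≤ bucketWeight σ p x ws := by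
  refine Finset.sum_le_sum fun y _ => ?_
  by_cases h : rank σ (w :: ws) x = rank σ (w :: ws) y ∧ x ≠ y
  · rw [if_pos h, if_pos ⟨eq_of_pivotStep_eq h.1, h.2⟩]
  · rw [if_neg h]
    split_ifs
    · exact hp y
    · exact le_rfl

/-- A random pivot is expected to shrink the bucket of weight `b` of any fixed element to
`b - b² / 6`. -/
theorem avg_bucketWeight_le (σ : Comparison n) {p : Fin n → ℝ} (hp : ∀ w, 0 ≤ p w)
    (hp1 : ∑ w, p w = 1) (x : Fin n) (ws : List (Fin n)) :
    avg p (bucketWeight σ p x) ws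
      ≤ bucketWeight σ p x ws - bucketWeight σ p x ws ^ 2 / 6 := by
  classical
  set b := bucketWeight σ p x ws with hb
  set r := rank σ ws with hr
  set q : Fin n → ℝ := fun w => if r x = r w ∧ x ≠ w then p w else 0 with hq
  have hq0 : ∀ w, 0 ≤ q w := by
    intro w
    simp only [hq]
    split_ifs
    · exact hp w
    · exact le_rfl
  have hb0 : 0 ≤ b := bucketWeight_nonneg σ hp x ws
  have hbq : ∑ w, q w = b := rfl
  have h1 := cube_sum_le σ hq0
  rw [hbq] at h1
  set lo : Fin n → ℝ := fun w => ∑ a, if a = w ∨ σ.lt a w = true then q a else 0 with hlo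
  set hi : Fin n → ℝ := fun w => ∑ c, if c = w ∨ σ.lt w c = true then q c else 0 with hhi
  have hlob : ∀ w, lo w ≤ b := fun w => by
    rw [← hbq]
    refine Finset.sum_le_sum fun a _ => ?_
    split_ifs
    · exact le_rfl
    · exact hq0 a
  have hhib : ∀ w, hi w ≤ b := fun w => by
    rw [← hbq]
    refine Finset.sum_le_sum fun a _ => ?_
    split_ifs
    · exact le_rfl
    · exact hq0 a
  have hlo0 : ∀ w, 0 ≤ lo w := fun w => Finset.sum_nonneg fun a _ => by
    split_ifs
    · exact hq0 a
    · exact le_rfl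
  have hhi0 : ∀ w, 0 ≤ hi w := fun w => Finset.sum_nonneg fun a _ => by
    split_ifs
    · exact hq0 a
    · exact le_rfl
  -- The elements on the other side of the pivot `w` from `x`, and `w` itself, leave the bucket.
  have h2 : ∀ w, q w * (lo w * hi w) ≤ b * (p w * (b - bucketWeight σ p x (w :: ws))) := by
    intro w
    have hmono : bucketWeight σ p x (w :: ws) ≤ b := bucketWeight_cons_le σ hp x w ws
    by_cases hw : r x = r w ∧ x ≠ w
    swap
    · have : q w = 0 := if_neg hw
      rw [this, zero_mul]
      exact mul_nonneg hb0 (mul_nonneg (hp w) (by linarith))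
    have hqw : q w = p w := if_pos hw
    have h3 : ∀ (P : Fin n → Prop) [DecidablePred P],
        (∀ y, rank σ (w :: ws) x = rank σ (w :: ws) y → ¬ P y) →
        (∑ a, if P a then q a else 0) ≤ b - bucketWeight σ p x (w :: ws) := by
      intro P _ hP
      rw [le_sub_iff_add_le, ← hbq, bucketWeight, ← Finset.sum_add_distrib]
      refine Finset.sum_le_sum fun y _ => ?_
      by_cases hy : rank σ (w :: ws) x = rank σ (w :: ws) y ∧ x ≠ y
      · have : q y = p y := if_pos ⟨eq_of_pivotStep_eq hy.1, hy.2⟩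
        rw [if_pos hy, if_neg (hP y hy.1), this, zero_add]
      · rw [if_neg hy, add_zero]
        split_ifs
        · exact le_rfl
        · exact hq0 y
    have hside : ∀ y, rank σ (w :: ws) x = rank σ (w :: ws) y → y ≠ w ∧ σ.lt x w = σ.lt y w := by
      intro y hy
      have hy0 : r x = r y := eq_of_pivotStep_eq hy
      have hyw : y ≠ w := by
        rintro rfl
        exact hw.2 (pivotStep_eq_pivot hy)
      refine ⟨hyw, ?_⟩
      change pivotStep σ r w x = pivotStep σ r w y at hy
      unfold pivotStep at hy
      rw [← hy0] at hy
      simp only [hw.1, hw.2, hyw, if_true, if_false] at hy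
      cases h4 : σ.lt x w <;> cases h5 : σ.lt y w <;> simp [h4, h5] at hy ⊢
    rw [hqw]
    have h4 : lo w * hi w ≤ b * (b - bucketWeight σ p x (w :: ws)) := by
      cases hxw : σ.lt x w with
      | true =>
        refine mul_le_mul (hlob w) (h3 _ fun y hy => ?_) (hhi0 w) hb0
        obtain ⟨h5, h6⟩ := hside y hy
        rintro (h7 | h7)
        · exact h5 h7
        · rw [σ.lt_swap _ _ h5, ← h6, hxw] at h7
          cases h7
      | false =>
        rw [mul_comm]
        refine mul_le_mul (hhib w) (h3 _ fun y hy => ?_) (hlo0 w) hb0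
        obtain ⟨h5, h6⟩ := hside y hy
        rintro (h7 | h7)
        · exact h5 h7
        · rw [← h6, hxw] at h7
          cases h7
    calc p w * (lo w * hi w) ≤ p w * (b * (b - bucketWeight σ p x (w :: ws))) :=
          mul_le_mul_of_nonneg_left h4 (hp w)
      _ = _ := by ring
  have h5 : ∑ w, q w * (lo w * hi w) ≤ b * (b - avg p (bucketWeight σ p x) ws) := by
    refine (Finset.sum_le_sum fun w _ => h2 w).trans (le_of_eq ?_)
    rw [← Finset.mul_sum, avg_apply]
    simp_rw [mul_sub]
    rw [Finset.sum_sub_distrib, ← Finset.sum_mul, hp1, one_mul, mul_sub]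
  rcases hb0.eq_or_lt with h0 | h0
  · have : avg p (bucketWeight σ p x) ws ≤ ∑ w, p w * b := by
      rw [avg_apply]
      exact Finset.sum_le_sum fun w _ =>
      mul_le_mul_of_nonneg_left (bucketWeight_cons_le σ hp x w ws) (hp w)
    rw [← Finset.sum_mul, hp1, one_mul] at this
    rw [← h0] at this ⊢
    simpa using this
  · have h6 : b * b ^ 2 ≤ b * (6 * (b - avg p (bucketWeight σ p x) ws)) := by
      calc b * b ^ 2 = b ^ 3 := by ring
        _ ≤ _ := h1
        _ ≤ 6 * (b * (b - avg p (bucketWeight σ p x) ws)) :=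
          mul_le_mul_of_nonneg_left h5 (by norm_num)
        _ = _ := by ring
    have h7 := le_of_mul_le_mul_left h6 h0
    linarith

theorem avg_pow_bucketWeight_le (σ : Comparison n) {p : Fin n → ℝ} (hp : ∀ w, 0 ≤ p w)
    (hp1 : ∑ w, p w = 1) (x : Fin n) (k : ℕ) :
    (avg p ^ k) (bucketWeight σ p x) [] ≤ 6 / (k + 1) := by
  set a : ℕ → ℝ := fun k => (avg p ^ k) (bucketWeight σ p x) [] with ha
  have hstep : ∀ k, a (k + 1) ≤ a k - a k ^ 2 / 6 := by
    intro k
    have h1 : a (k + 1) ≤ (avg p ^ k)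
        (bucketWeight σ p x - (1 / 6 : ℝ) • fun ws => bucketWeight σ p x ws ^ 2) [] := by
      simp only [ha]
      rw [avg_pow_succ_apply]
      refine avg_pow_mono hp k (fun ws => ?_) []
      refine (avg_bucketWeight_le σ hp hp1 x ws).trans (le_of_eq ?_)
      simp only [Pi.sub_apply, Pi.smul_apply, smul_eq_mul]
      ring
    rw [map_sub, map_smul] at h1
    simp only [Pi.sub_apply, Pi.smul_apply, smul_eq_mul] at h1
    have h2 := sq_avg_pow_le hp hp1 k (bucketWeight σ p x) []
    have h3 : a k ^ 2 ≤ (avg p ^ k) (fun ws => bucketWeight σ p x ws ^ 2) [] := h2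
    have h4 : (avg p ^ k) (bucketWeight σ p x) [] = a k := rfl
    linarith
  have h0 : a 0 ≤ 1 := by
    have : a 0 = bucketWeight σ p x [] := rfl
    rw [this, ← hp1]
    refine Finset.sum_le_sum fun w _ => ?_
    split_ifs
    · exact le_rfl
    · exact hp w
  have hnn : ∀ k, 0 ≤ a k := fun k =>
    avg_pow_nonneg hp k (fun ws => bucketWeight_nonneg σ hp x ws) []
  show a k ≤ 6 / (k + 1)
  induction k with
  | zero => norm_num; linarith
  | succ k ih =>
    have hs := hstep k
    rcases Nat.eq_zero_or_pos k with rfl | hk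
    · norm_num
      nlinarith [sq_nonneg (a 0)]
    · have hk' : (1 : ℝ) ≤ k := by exact_mod_cast hk
      have hkp : (0 : ℝ) < k + 1 := by linarith
      set y : ℝ := 6 / (k + 1) with hy
      have hy3 : y ≤ 3 := by rw [hy, div_le_iff₀ hkp]; linarith
      have h1 : a k - a k ^ 2 / 6 ≤ y - y ^ 2 / 6 := by
        nlinarith [mul_nonneg (sub_nonneg.2 ih) (by linarith [hnn k] : 0 ≤ 6 - y - a k)]
      have h2 : y - y ^ 2 / 6 ≤ 6 / ((k : ℝ) + 1 + 1) := by
        rw [hy, le_div_iff₀ (by linarith)]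
        have : (6 / ((k : ℝ) + 1) - (6 / (k + 1)) ^ 2 / 6) * (k + 1 + 1)
            = 6 - 6 / (k + 1) ^ 2 := by
          field_simp
          ring
        rw [this]
        have : 0 < 6 / ((k : ℝ) + 1) ^ 2 := by positivity
        linarith
      push_cast
      linarith

/-! ### The quicksort tester -/

/-- Computes the rank of `v` with respect to a list of pivots, each given with its own rank at the
time it was used, and passes it to `k`. Only pivots of the current bucket of `v` are compared with
`v`. -/
def locate : List (Fin n × ℕ) → Fin n → (ℕ → Tree n) → Tree n
  | [], _, k => k 0
  | (w, a) :: L, v, k => locate L v fun c =>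
      if c = a then
        if h : v = w then k (3 * c + 1)
        else Tree.query v w h fun b => k (if b then 3 * c else 3 * c + 2)
      else k (3 * c + 1)

/-- Draws `k` samples and rejects if the ranks separate one of them in the wrong order. -/
def checkSamples (L : List (Fin n × ℕ)) : ℕ → Tree n
  | 0 => Tree.answer true
  | k + 1 => Tree.sample fun e => locate L (fstEnd e) fun a => locate L (sndEnd e) fun b =>
      Tree.query (fstEnd e) (sndEnd e) (fstEnd_ne_sndEnd e) fun c =>
        if (b < a ∧ c = true) ∨ (a < b ∧ c = false) then Tree.answer false else checkSamples L k

/-- Uses the smaller endpoints of `k` samples as pivots, and then checks `m` further samples. -/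
def quicksortTester (m : ℕ) : ℕ → List (Fin n × ℕ) → Tree n
  | 0, L => checkSamples L m
  | k + 1, L => Tree.sample fun e => locate L (fstEnd e) fun a =>
      quicksortTester m k ((fstEnd e, a) :: L)

/-- The pivots with their ranks at the time they were used. -/
def rankedPivots (σ : Comparison n) : List (Fin n) → List (Fin n × ℕ)
  | [] => []
  | w :: ws => (w, rank σ ws w) :: rankedPivots σ ws

open Classical in
/-- The number of pivots with which `x` is compared when its rank is computed. -/
noncomputable def comparisons (σ : Comparison n) (x : Fin n) : List (Fin n) → ℝ
  | [] => 0
  | w :: ws => comparisons σ x ws + if rank σ ws x = rank σ ws w ∧ x ≠ w then 1 else 0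

theorem acc_locate (σ : Comparison n) (d : Pair n → ℝ) (ws : List (Fin n)) (v : Fin n)
    (k : ℕ → Tree n) :
    (locate (rankedPivots σ ws) v k).acc σ d = (k (rank σ ws v)).acc σ d := by
  induction ws generalizing k with
  | nil => rfl
  | cons w ws ih =>
    rw [rankedPivots, locate, ih, rank, pivotStep]
    by_cases h1 : rank σ ws v = rank σ ws w
    · by_cases h2 : v = w
      · subst h2; simp
      · simp [h1, h2, Tree.acc]
    · simp [h1]

theorem expCost_locate (σ : Comparison n) (d : Pair n → ℝ) (ws : List (Fin n)) (v : Fin n)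
    (k : ℕ → Tree n) :
    (locate (rankedPivots σ ws) v k).expCost σ d
      = comparisons σ v ws + (k (rank σ ws v)).expCost σ d := by
  induction ws generalizing k with
  | nil => simp [rankedPivots, locate, comparisons, rank]
  | cons w ws ih =>
    rw [rankedPivots, locate, ih, rank, pivotStep, comparisons]
    by_cases h1 : rank σ ws v = rank σ ws w
    · by_cases h2 : v = w
      · subst h2; simp
      · simp [h1, h2, Tree.expCost, add_assoc]
    · simp [h1]

theorem violated_iff (σ : Comparison n) (r : Fin n → ℕ) (e : Pair n) :
    Violated σ r e ↔ (r (sndEnd e) < r (fstEnd e) ∧ σ.lt (fstEnd e) (sndEnd e) = true) ∨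
      (r (fstEnd e) < r (sndEnd e) ∧ σ.lt (fstEnd e) (sndEnd e) = false) := by
  have h := σ.lt_swap _ _ (fstEnd_ne_sndEnd e)
  unfold Violated Misplaced
  rw [h, or_comm]
  simp

theorem acc_checkSamples (σ : Comparison n) {d : Pair n → ℝ} (hd1 : ∑ e, d e = 1)
    (ws : List (Fin n)) (k : ℕ) :
    (checkSamples (rankedPivots σ ws) k).acc σ d = (1 - violation σ d (rank σ ws)) ^ k := by
  classical
  induction k with
  | zero => simp [checkSamples, Tree.acc]
  | succ k ih =>
    rw [checkSamples, Tree.acc, pow_succ', ← ih, violation, ← hd1, ← Finset.sum_sub_distrib,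
      Finset.sum_mul]
    refine Finset.sum_congr rfl fun e _ => ?_
    rw [acc_locate, acc_locate, Tree.acc]
    by_cases h : Violated σ (rank σ ws) e
    · rw [if_pos ((violated_iff σ _ e).1 h), if_pos h]
      simp [Tree.acc]
    · rw [if_neg fun h' => h ((violated_iff σ _ e).2 h'), if_neg h, sub_zero]

theorem acc_quicksortTester (σ : Comparison n) {d : Pair n → ℝ} (hd1 : ∑ e, d e = 1) (m k : ℕ)
    (ws : List (Fin n)) :
    (quicksortTester m k (rankedPivots σ ws)).acc σ d
      = (avg (endWeight d) ^ k) (fun ws => (1 - violation σ d (rank σ ws)) ^ m) ws := by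
  induction k generalizing ws with
  | zero => exact acc_checkSamples σ hd1 ws m
  | succ k ih =>
    rw [quicksortTester, Tree.acc, avg_pow_succ_apply', avg_apply, ← sum_mul_fstEnd]
    refine Finset.sum_congr rfl fun e _ => ?_
    rw [acc_locate, ← ih]
    rfl

/-! ### The expected number of steps -/

theorem expCost_checkSamples_le (σ : Comparison n) {d : Pair n → ℝ} (hd : ∀ e, 0 ≤ d e)
    (hd1 : ∑ e, d e = 1) (ws : List (Fin n)) (k : ℕ) :
    (checkSamples (rankedPivots σ ws) k).expCost σ d
      ≤ k * (2 + ∑ e, d e * (comparisons σ (fstEnd e) ws + comparisons σ (sndEnd e) ws)) := by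
  induction k with
  | zero => simp [checkSamples, Tree.expCost]
  | succ k ih =>
    set c := (checkSamples (rankedPivots σ ws) k).expCost σ d with hc
    have hc0 : 0 ≤ c := Tree.expCost_nonneg hd _
    rw [checkSamples, Tree.expCost]
    have h1 : ∀ e, d e * (locate (rankedPivots σ ws) (fstEnd e) fun a =>
        locate (rankedPivots σ ws) (sndEnd e) fun b =>
        Tree.query (fstEnd e) (sndEnd e) (fstEnd_ne_sndEnd e) fun c =>
        if (b < a ∧ c = true) ∨ (a < b ∧ c = false) then Tree.answer false
        else checkSamples (rankedPivots σ ws) k).expCost σ d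
        ≤ d e * (comparisons σ (fstEnd e) ws + comparisons σ (sndEnd e) ws) + d e * (1 + c) := by
      intro e
      rw [← mul_add]
      refine mul_le_mul_of_nonneg_left ?_ (hd e)
      rw [expCost_locate, expCost_locate, Tree.expCost]
      split_ifs
      · simp only [Tree.expCost]; linarith
      · linarith
    have h2 := Finset.sum_le_sum fun e (_ : e ∈ Finset.univ) => h1 e
    rw [Finset.sum_add_distrib, ← Finset.sum_mul, hd1, one_mul] at h2
    push_cast
    linarith

theorem expCost_quicksortTester_le (σ : Comparison n) {d : Pair n → ℝ} (hd : ∀ e, 0 ≤ d e)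
    (hd1 : ∑ e, d e = 1) (m k : ℕ) (ws : List (Fin n)) :
    (quicksortTester m k (rankedPivots σ ws)).expCost σ d
      ≤ ∑ j ∈ Finset.range k, (avg (endWeight d) ^ j)
          (fun ws => 1 + ∑ w, endWeight d w * comparisons σ w ws) ws
        + (avg (endWeight d) ^ k) (fun ws => m * (2 + ∑ e, d e *
          (comparisons σ (fstEnd e) ws + comparisons σ (sndEnd e) ws))) ws := by
  set p := endWeight d with hp
  set G : List (Fin n) → ℝ := fun ws => 1 + ∑ w, p w * comparisons σ w ws with hG
  set K : List (Fin n) → ℝ := fun ws => m * (2 + ∑ e, d e *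
    (comparisons σ (fstEnd e) ws + comparisons σ (sndEnd e) ws)) with hK
  induction k generalizing ws with
  | zero =>
    rw [Finset.sum_range_zero, zero_add]
    exact expCost_checkSamples_le σ hd hd1 ws m
  | succ k ih =>
    have h1 : (quicksortTester m (k + 1) (rankedPivots σ ws)).expCost σ d
        = G ws + ∑ w, p w * (quicksortTester m k (rankedPivots σ (w :: ws))).expCost σ d := by
      rw [quicksortTester, Tree.expCost, hG, add_assoc, hp, ← sum_mul_fstEnd, ← sum_mul_fstEnd,
        ← Finset.sum_add_distrib]
      congr 1
      refine Finset.sum_congr rfl fun e _ => ?_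
      rw [expCost_locate, mul_add]
      rfl
    have h2 : ∑ w, p w * (quicksortTester m k (rankedPivots σ (w :: ws))).expCost σ d
        ≤ ∑ w, p w * (∑ j ∈ Finset.range k, (avg p ^ j) G (w :: ws) + (avg p ^ k) K (w :: ws)) :=
      Finset.sum_le_sum fun w _ => mul_le_mul_of_nonneg_left (ih _) (endWeight_nonneg hd w)
    have h3 : ∑ w, p w * (∑ j ∈ Finset.range k, (avg p ^ j) G (w :: ws) + (avg p ^ k) K (w :: ws))
        = ∑ j ∈ Finset.range k, (avg p ^ (j + 1)) G ws + (avg p ^ (k + 1)) K ws := by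
      simp_rw [avg_pow_succ_apply', avg_apply, mul_add, Finset.sum_add_distrib, Finset.mul_sum]
      rw [Finset.sum_comm]
    rw [Finset.sum_range_succ', h1]
    have h4 : (avg p ^ 0) G ws = G ws := rfl
    linarith

theorem avg_comparisons (σ : Comparison n) {p : Fin n → ℝ} (hp1 : ∑ w, p w = 1) (x : Fin n) :
    avg p (comparisons σ x) = comparisons σ x + bucketWeight σ p x := by
  classical
  ext ws
  rw [avg_apply, Pi.add_apply, bucketWeight]
  simp_rw [comparisons, mul_add]
  rw [Finset.sum_add_distrib, ← Finset.sum_mul, hp1, one_mul]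
  simp

/-- A fixed element is compared with `O(log m)` of `m` random pivots on average. -/
theorem avg_pow_comparisons_le (σ : Comparison n) {p : Fin n → ℝ} (hp : ∀ w, 0 ≤ p w)
    (hp1 : ∑ w, p w = 1) (x : Fin n) {j m : ℕ} (hjm : j ≤ m) :
    (avg p ^ j) (comparisons σ x) [] ≤ 6 * (1 + Real.log m) := by
  have h1 : (avg p ^ j) (comparisons σ x) [] ≤ 6 * harmonic j := by
    clear hjm
    induction j with
    | zero => simp [comparisons]
    | succ j ih =>
      rw [avg_pow_succ_apply, avg_comparisons σ hp1, map_add, Pi.add_apply, harmonic_succ]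
      have := avg_pow_bucketWeight_le σ hp hp1 x j
      push_cast
      rw [div_eq_mul_inv] at this
      linarith
  rcases Nat.eq_zero_or_pos j with rfl | hj
  · refine h1.trans ?_
    have : 0 ≤ Real.log m := Real.log_natCast_nonneg m
    simp only [harmonic_zero, Rat.cast_zero, mul_zero]
    positivity
  · have h2 := harmonic_le_one_add_log j
    have h3 : Real.log j ≤ Real.log m :=
      Real.log_le_log (by exact_mod_cast hj) (by exact_mod_cast hjm)
    linarith

theorem expCost_quicksortTester_nil_le (σ : Comparison n) {d : Pair n → ℝ} (hd : ∀ e, 0 ≤ d e)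
    (hd1 : ∑ e, d e = 1) (m : ℕ) :
    (quicksortTester m m []).expCost σ d ≤ 3 * m * (1 + 6 * (1 + Real.log m)) := by
  set H := 6 * (1 + Real.log m) with hH
  set p := endWeight d with hp
  have hp0 : ∀ w, 0 ≤ p w := endWeight_nonneg hd
  have hp1 : ∑ w, p w = 1 := (sum_endWeight d).trans hd1
  have hc : ∀ j ≤ m, ∀ x, (avg p ^ j) (comparisons σ x) [] ≤ H := fun j hj x =>
    avg_pow_comparisons_le σ hp0 hp1 x hj
  have h1 := expCost_quicksortTester_le σ hd hd1 m m []
  have h2 : ∀ j ∈ Finset.range m,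
      (avg p ^ j) (fun ws => 1 + ∑ w, p w * comparisons σ w ws) [] ≤ 1 + H := by
    intro j hj
    have h3 : (fun ws => 1 + ∑ w, p w * comparisons σ w ws)
        = (fun _ => 1) + fun ws => ∑ w, p w * comparisons σ w ws := rfl
    rw [h3, map_add, Pi.add_apply, avg_pow_const hp1, avg_pow_sum]
    have h4 : ∑ w, p w * (avg p ^ j) (comparisons σ w) [] ≤ ∑ w, p w * H :=
      Finset.sum_le_sum fun w _ =>
        mul_le_mul_of_nonneg_left (hc j (Finset.mem_range.1 hj).le w) (hp0 w)
    rw [← Finset.sum_mul, hp1, one_mul] at h4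
    linarith
  have h5 : (avg p ^ m) (fun ws => m * (2 + ∑ e, d e *
      (comparisons σ (fstEnd e) ws + comparisons σ (sndEnd e) ws))) [] ≤ m * (2 + 2 * H) := by
    have h6 : (fun ws => (m : ℝ) * (2 + ∑ e, d e *
        (comparisons σ (fstEnd e) ws + comparisons σ (sndEnd e) ws)))
        = (m : ℝ) • ((fun _ => 2) + ((fun ws => ∑ e, d e * comparisons σ (fstEnd e) ws)
          + fun ws => ∑ e, d e * comparisons σ (sndEnd e) ws)) := by
      ext ws
      simp [mul_add, Finset.sum_add_distrib]
    rw [h6, map_smul, map_add, map_add, Pi.smul_apply, Pi.add_apply, Pi.add_apply, smul_eq_mul,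
      avg_pow_const hp1, avg_pow_sum, avg_pow_sum]
    have h7 : ∀ g : Pair n → Fin n,
        ∑ e, d e * (avg p ^ m) (comparisons σ (g e)) [] ≤ H := by
      intro g
      have h8 : ∑ e, d e * (avg p ^ m) (comparisons σ (g e)) [] ≤ ∑ e, d e * H :=
        Finset.sum_le_sum fun e _ => mul_le_mul_of_nonneg_left (hc m le_rfl _) (hd e)
      rwa [← Finset.sum_mul, hd1, one_mul] at h8
    have h9 := h7 fstEnd
    have h10 := h7 sndEnd
    exact mul_le_mul_of_nonneg_left (by linarith) (Nat.cast_nonneg m)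
  have h11 := Finset.sum_le_sum h2
  rw [Finset.sum_const, Finset.card_range, nsmul_eq_mul] at h11
  calc _ ≤ _ := h1
    _ ≤ m * (1 + H) + m * (2 + 2 * H) := add_le_add h11 h5
    _ = _ := by ring

/-! ### Soundness of the quicksort tester -/

theorem acc_quicksortTester_of_isTotal {σ : Comparison n} (hσ : σ.IsTotal) {d : Pair n → ℝ}
    (hd1 : ∑ e, d e = 1) (m : ℕ) : (quicksortTester m m []).acc σ d = 1 := by
  have h := acc_quicksortTester σ hd1 m m []
  simp_rw [violation_eq_zero hσ, sub_zero, one_pow] at h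
  rw [avg_pow_const ((sum_endWeight d).trans hd1)] at h
  exact h

open Classical in
/-- The probability that `k` random pivots violate less than `δ`. The potential
`max 0 (2 δ - violation)` decreases by at least `ε² / (16 n)` in expectation as long as this is
the case. -/
theorem IsFar.avg_pow_violation_lt {D : PMF (Pair n)} {σ : Comparison n} {ε δ : ℝ}
    (h : IsFar D σ ε) (hn : 0 < n) (hε : 0 < ε) (hδ : ε / (4 * n) ≤ δ) (hδ' : δ ≤ ε / 2) (k : ℕ)
    (ws : List (Fin n)) :
    ε ^ 2 / (16 * n) * k * (avg (endWeight (weight D)) ^ k)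
      (fun ws => if violation σ (weight D) (rank σ ws) < δ then 1 else 0) ws ≤ 2 * δ := by
  set p := endWeight (weight D) with hp
  have hp0 : ∀ w, 0 ≤ p w := endWeight_nonneg (weight_nonneg D)
  have hp1 : ∑ w, p w = 1 := (sum_endWeight _).trans (sum_weight D)
  set V : List (Fin n) → ℝ := fun ws => violation σ (weight D) (rank σ ws) with hV
  set I : List (Fin n) → ℝ := fun ws => if V ws < δ then 1 else 0 with hI
  set Z : List (Fin n) → ℝ := fun ws => max 0 (2 * δ - V ws) with hZ
  set γ := ε ^ 2 / (16 * n) with hγ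
  have hγ0 : 0 ≤ γ := by positivity
  have hV0 : ∀ ws, 0 ≤ V ws := fun ws => violation_nonneg (weight_nonneg D) _
  have hVc : ∀ w ws, V (w :: ws) = V ws + pivotLoss σ (weight D) (rank σ ws) w := by
    intro w ws
    simp only [hV, pivotLoss, rank]
    ring
  have hVmono : ∀ w ws, V ws ≤ V (w :: ws) := by
    intro w ws
    rw [hVc]
    linarith [pivotLoss_nonneg (weight_nonneg D) (rank σ ws) w (σ := σ)]
  have hI0 : ∀ ws, 0 ≤ I ws := by
    intro ws
    simp only [hI]
    split_ifs <;> norm_num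
  have hδ0 : 0 < δ := lt_of_lt_of_le (by positivity) hδ
  have havgI : ∀ ws, avg p I ws ≤ I ws := by
    intro ws
    have : avg p I ws ≤ ∑ w, p w * I ws := by
      rw [avg_apply]
      refine Finset.sum_le_sum fun w _ => mul_le_mul_of_nonneg_left ?_ (hp0 w)
      by_cases h1 : V (w :: ws) < δ
      · have h2 : V ws < δ := (hVmono w ws).trans_lt h1
        simp [hI, h1, h2]
      · have h3 : I (w :: ws) = 0 := if_neg h1
        rw [h3]
        exact hI0 ws
    rwa [← Finset.sum_mul, hp1, one_mul] at this
  have havgZ : ∀ ws, avg p Z ws ≤ Z ws - γ * I ws := by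
    intro ws
    by_cases h1 : V ws < δ
    · have h2 := h.le_sum_mul_min hn hε hδ (ws := ws) (by linarith : V ws ≤ ε / 2)
      have hIw : I ws = 1 := if_pos h1
      have hZw : Z ws = 2 * δ - V ws := max_eq_right (by linarith)
      have h3 : avg p Z ws ≤ ∑ w, (p w * Z ws
          - p w * min (pivotLoss σ (weight D) (rank σ ws) w) δ) := by
        rw [avg_apply]
        refine Finset.sum_le_sum fun w _ => ?_
        rw [← mul_sub]
        refine mul_le_mul_of_nonneg_left (max_le ?_ ?_) (hp0 w)
        · have := min_le_right (pivotLoss σ (weight D) (rank σ ws) w) δ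
          linarith
        · have := min_le_left (pivotLoss σ (weight D) (rank σ ws) w) δ
          rw [hVc]
          linarith
      rw [Finset.sum_sub_distrib, ← Finset.sum_mul, hp1, one_mul] at h3
      rw [hIw]
      linarith
    · have hIw : I ws = 0 := if_neg h1
      have h3 : avg p Z ws ≤ ∑ w, p w * Z ws := by
        rw [avg_apply]
        refine Finset.sum_le_sum fun w _ => mul_le_mul_of_nonneg_left ?_ (hp0 w)
        exact max_le_max le_rfl (by linarith [hVmono w ws])
      rw [← Finset.sum_mul, hp1, one_mul] at h3
      rw [hIw]
      linarith
  have key : ∀ (k : ℕ) (ws : List (Fin n)),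
      (avg p ^ k) Z ws + γ * k * (avg p ^ k) I ws ≤ Z ws := by
    intro k ws
    induction k with
    | zero => simp
    | succ k ih =>
      have h1 : (avg p ^ (k + 1)) Z ws ≤ (avg p ^ k) (Z - γ • I) ws := by
        rw [avg_pow_succ_apply]
        exact avg_pow_mono hp0 k havgZ ws
      rw [map_sub, map_smul, Pi.sub_apply, Pi.smul_apply, smul_eq_mul] at h1
      have h2 : (avg p ^ (k + 1)) I ws ≤ (avg p ^ k) I ws := by
        rw [avg_pow_succ_apply]
        exact avg_pow_mono hp0 k havgI ws
      have h3 : γ * (k + 1) * (avg p ^ (k + 1)) I ws ≤ γ * (k + 1) * (avg p ^ k) I ws :=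
        mul_le_mul_of_nonneg_left h2 (by positivity)
      push_cast
      linarith
  have h4 := key k ws
  have h5 : 0 ≤ (avg p ^ k) Z ws := avg_pow_nonneg hp0 k (fun ws => le_max_left _ _) ws
  have h6 : Z ws ≤ 2 * δ := max_le (by linarith) (by linarith [hV0 ws])
  linarith

theorem IsFar.acc_quicksortTester_le {D : PMF (Pair n)} {σ : Comparison n} {ε δ : ℝ}
    (h : IsFar D σ ε) (hn : 0 < n) (hε : 0 < ε) (hδ : ε / (4 * n) ≤ δ) (hδ' : δ ≤ ε / 2)
    (hδ1 : δ ≤ 1) {m : ℕ} (hm : 0 < m) :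
    (quicksortTester m m []).acc σ (weight D)
      ≤ 2 * δ / (ε ^ 2 / (16 * n) * m) + (1 - δ) ^ m := by
  classical
  set p := endWeight (weight D) with hp
  have hp0 : ∀ w, 0 ≤ p w := endWeight_nonneg (weight_nonneg D)
  have hp1 : ∑ w, p w = 1 := (sum_endWeight _).trans (sum_weight D)
  have h1 := acc_quicksortTester σ (sum_weight D) m m []
  have h2 := h.avg_pow_violation_lt hn hε hδ hδ' m []
  set I : List (Fin n) → ℝ :=
    fun ws => if violation σ (weight D) (rank σ ws) < δ then 1 else 0 with hI
  have h3 : (avg p ^ m) (fun ws => (1 - violation σ (weight D) (rank σ ws)) ^ m) []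
      ≤ (avg p ^ m) (I + fun _ => (1 - δ) ^ m) [] := by
    refine avg_pow_mono hp0 m (fun ws => ?_) []
    have hV0 := violation_nonneg (σ := σ) (weight_nonneg D) (rank σ ws)
    have hV1 := violation_le_one (σ := σ) (weight_nonneg D) (sum_weight D) (rank σ ws)
    simp only [hI, Pi.add_apply]
    split_ifs with h4
    · have h5 : (1 - violation σ (weight D) (rank σ ws)) ^ m ≤ 1 :=
        pow_le_one₀ (by linarith) (by linarith)
      have h6 : 0 ≤ (1 - δ) ^ m := pow_nonneg (by linarith) m
      linarith
    · rw [zero_add]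
      exact pow_le_pow_left₀ (by linarith) (by linarith) m
  rw [map_add, Pi.add_apply, avg_pow_const hp1] at h3
  have hn' : (0 : ℝ) < n := Nat.cast_pos.2 hn
  have hm' : (0 : ℝ) < m := Nat.cast_pos.2 hm
  have h7 : (avg p ^ m) I [] ≤ 2 * δ / (ε ^ 2 / (16 * n) * m) := by
    rw [le_div_iff₀ (by positivity)]
    linarith
  calc _ = _ := h1
    _ ≤ _ := h3
    _ ≤ _ := by linarith

/-! ### The exhaustive tester -/

/-- Makes all the comparisons in the list and decides by their results. -/
def askAll : List {p : Fin n × Fin n // p.1 ≠ p.2} → (List Bool → Bool) → Tree n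
  | [], f => Tree.answer (f [])
  | p :: l, f => Tree.query p.1.1 p.1.2 p.2 fun b => askAll l fun bs => f (b :: bs)

theorem cost_askAll (l : List {p : Fin n × Fin n // p.1 ≠ p.2}) (f : List Bool → Bool) :
    (askAll l f).cost = l.length := by
  induction l generalizing f with
  | nil => rfl
  | cons p l ih => rw [askAll, Tree.cost, ih, ih, max_self, List.length_cons, add_comm]

theorem acc_askAll (σ : Comparison n) (d : Pair n → ℝ)
    (l : List {p : Fin n × Fin n // p.1 ≠ p.2}) (f : List Bool → Bool) :
    (askAll l f).acc σ d = if f (l.map fun p => σ.lt p.1.1 p.1.2) then 1 else 0 := by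
  induction l generalizing f with
  | nil => rfl
  | cons p l ih => rw [askAll, Tree.acc, ih]; rfl

theorem not_isFar_of_isTotal {D : PMF (Pair n)} {σ : Comparison n} {ε : ℝ} (hε : 0 < ε)
    (hσ : σ.IsTotal) : ¬ IsFar D σ ε := by
  intro h
  have h1 := h σ hσ
  have h2 : disagreement σ σ = ∅ := by
    ext e
    rw [mem_disagreement_iff, σ.lt_swap _ _ (fstEnd_ne_sndEnd e)]
    simp
  rw [distance, h2] at h1
  simp [hε.not_ge] at h1

theorem exists_exhaustive_tester (n : ℕ) {ε : ℝ} (hε : 0 < ε) :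
    ∃ A : Algorithm n, A.IsTester ε ∧ A.QueriesLE (n ^ 2) := by
  classical
  set l := (Finset.univ : Finset {p : Fin n × Fin n // p.1 ≠ p.2}).toList with hl
  set f : List Bool → Bool := fun bs =>
    decide (∃ τ : Comparison n, τ.IsTotal ∧ (l.map fun p => τ.lt p.1.1 p.1.2) = bs) with hf
  refine ⟨PMF.pure (askAll l f), isTester_pure _ ?_ ?_, queriesLE_pure ?_⟩
  · intro σ D hσ
    rw [acc_askAll]
    have : f (l.map fun p => σ.lt p.1.1 p.1.2) = true := decide_eq_true ⟨σ, hσ, rfl⟩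
    rw [if_pos this]
    norm_num
  · intro σ D hfar
    rw [acc_askAll]
    have : ¬ f (l.map fun p => σ.lt p.1.1 p.1.2) = true := by
      intro h
      obtain ⟨τ, hτ, h1⟩ := of_decide_eq_true h
      rw [List.map_inj_left] at h1
      have h2 : τ = σ := by
        have h3 : τ.lt = σ.lt := by
          ext u v
          by_cases huv : u = v
          · rw [huv, τ.lt_irrefl, σ.lt_irrefl]
          · rw [h1 ⟨(u, v), huv⟩ (Finset.mem_toList.2 (Finset.mem_univ _))]
        cases τ; cases σ; cases h3; rfl
      exact not_isFar_of_isTotal hε (h2 ▸ hτ) hfar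
    rw [if_neg this]
    norm_num
  · rw [cost_askAll, hl, Finset.length_toList, Finset.card_univ]
    calc Fintype.card {p : Fin n × Fin n // p.1 ≠ p.2} ≤ Fintype.card (Fin n × Fin n) :=
          Fintype.card_subtype_le _
      _ = n ^ 2 := by simp [sq]

/-! ### The upper bound -/

/-- With `m ≈ 64 √n / ε` pivots and samples, cut off at ten times the bound for its expected
number of steps, the quicksort tester errs with probability at most `0.3`: too little violated,
violation undetected, and cut-off contribute at most `0.1` each. -/
theorem exists_quicksort_tester (hn : 2 ≤ n) {ε : ℝ} (hε : 0 < ε) (hε1 : ε ≤ 1) {m : ℕ}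
    (hm1 : 64 * √n / ε ≤ m) (hm2 : m ≤ 64 * √n / ε + 1) :
    ∃ A : Algorithm n, A.IsTester ε ∧
      A.QueriesLE ⌈30 * m * (1 + 6 * (1 + Real.log m))⌉₊ := by
  set B := m * (1 + 6 * (1 + Real.log m)) with hB
  set q := ⌈30 * m * (1 + 6 * (1 + Real.log m))⌉₊ with hq
  have hn' : (2 : ℝ) ≤ n := by exact_mod_cast hn
  have hsq : √n ^ 2 = n := Real.sq_sqrt (by linarith)
  have hs1 : 1.4 ≤ √(n : ℝ) := Real.le_sqrt_of_sq_le (by norm_num; linarith)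
  have hm1' : 64 * √n ≤ m * ε := (div_le_iff₀ hε).1 hm1
  have hm2' : m * ε ≤ 64 * √n + ε := by
    have := mul_le_mul_of_nonneg_right hm2 hε.le
    rwa [add_mul, div_mul_cancel₀ _ hε.ne', one_mul] at this
  have hmpos : (0 : ℝ) < m := lt_of_lt_of_le (by positivity) hm1
  have hm89 : (89 : ℝ) ≤ m := by
    have : (m : ℝ) * ε ≤ m := mul_le_of_le_one_right hmpos.le hε1
    linarith
  have hmN : 0 < m := Nat.cast_pos.1 hmpos
  refine ⟨PMF.pure ((quicksortTester m m []).trunc q), isTester_pure _ ?_ ?_,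
    queriesLE_pure (Tree.cost_trunc_le _ _)⟩
  · intro σ D hσ
    have h1 := Tree.acc_le_acc_trunc (weight_nonneg D) (sum_weight D)
      (quicksortTester m m []) q (σ := σ)
    rw [acc_quicksortTester_of_isTotal hσ (sum_weight D)] at h1
    linarith
  · intro σ D hfar
    have h1 := hfar.acc_quicksortTester_le (δ := 12 / m) (by omega) hε ?_ ?_ ?_ hmN
    · have h2 : 2 * (12 / (m : ℝ)) / (ε ^ 2 / (16 * n) * m) ≤ 0.1 := by
        have h3 : 2 * (12 / (m : ℝ)) / (ε ^ 2 / (16 * n) * m) = 384 * n / (m * ε) ^ 2 := by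
          field_simp
          ring
        rw [h3, div_le_iff₀ (by positivity)]
        have h4 : (64 * √n) ^ 2 ≤ (m * ε) ^ 2 := pow_le_pow_left₀ (by positivity) hm1' 2
        rw [mul_pow, hsq] at h4
        linarith
      have h5 : (1 - 12 / (m : ℝ)) ^ m ≤ 0.1 := by
        have h6 : (1 - 12 / (m : ℝ)) ^ m ≤ Real.exp (-12) :=
          Real.one_sub_div_pow_le_exp_neg (by linarith)
        have h7 : Real.exp (-12) ≤ 0.1 := by
          rw [Real.exp_neg]
          have := Real.add_one_le_exp (12 : ℝ)
          rw [inv_le_comm₀ (Real.exp_pos _) (by norm_num)]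
          norm_num
          linarith
        linarith
      have hlog : 0 ≤ Real.log m := Real.log_natCast_nonneg m
      have h8 := Tree.acc_trunc_le (weight_nonneg D) (sum_weight D)
        (quicksortTester m m []) q (σ := σ)
      have h9 := expCost_quicksortTester_nil_le σ (weight_nonneg D) (sum_weight D) m
      have h10 : 30 * B ≤ q := by
        rw [hB, ← mul_assoc]
        exact Nat.le_ceil _
      have hBpos : 0 < B := by positivity
      have h11 : ((quicksortTester m m []).trunc q).acc σ (weight D)
          - (quicksortTester m m []).acc σ (weight D) ≤ 0.1 := by
        have h12 := Tree.acc_le_acc_trunc (weight_nonneg D) (sum_weight D)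
          (quicksortTester m m []) q (σ := σ)
        have h13 := mul_le_mul_of_nonneg_right h10 (sub_nonneg.2 h12)
        have h14 : B * (30 * (((quicksortTester m m []).trunc q).acc σ (weight D)
          - (quicksortTester m m []).acc σ (weight D))) ≤ B * 3 := by
          rw [hB] at h13 ⊢
          linarith
        have := le_of_mul_le_mul_left h14 hBpos
        linarith
      linarith
    · rw [div_le_div_iff₀ (by positivity) hmpos]
      nlinarith
    · rw [div_le_div_iff₀ hmpos (by norm_num)]
      linarith
    · rw [div_le_one hmpos]
      linarith

theorem exists_tester_le {n : ℕ} (hn : 2 ≤ n) {ε : ℝ} (hε : 0 < ε) :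
    ∃ (A : Algorithm n) (q : ℕ), A.IsTester ε ∧ A.QueriesLE q ∧
      (q : ℝ) ≤ 140000 * Real.log n ^ 1 * (√n / ε) := by
  have hn' : (2 : ℝ) ≤ n := by exact_mod_cast hn
  have hlog2 : 0.5 ≤ Real.log n := by
    have := Real.log_two_gt_d9
    have := Real.log_le_log (by norm_num) hn'
    linarith
  -- For `ε > 1` no comparison function is `ε`-far, and no queries are allowed for large `ε`.
  rcases lt_or_ge 1 ε with h1 | h1
  · refine ⟨PMF.pure (Tree.answer true), 0, isTester_pure _ ?_ ?_, queriesLE_pure le_rfl, ?_⟩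
    · intro σ D _
      simp only [Tree.acc, if_true]
      norm_num
    · intro σ D hfar
      have h2 := hfar.le_violation_add fun _ => 0
      have h3 : violation σ (weight D) (fun _ => 0) = 0 :=
        Finset.sum_eq_zero fun e _ => if_neg (by simp [Violated, Misplaced])
      simp only [h3, if_true, sum_weight] at h2
      linarith
    · norm_num
      positivity
  have hs : 1 ≤ √(n : ℝ) := Real.one_le_sqrt.2 (by linarith)
  set x := √n / ε with hx
  have hx1 : 1 ≤ x := by rw [hx, one_le_div hε]; linarith
  have hL : 0 ≤ Real.log n := by linarith
  rcases le_or_gt ((n : ℝ) ^ 2) x with h2 | h2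
  · obtain ⟨A, hA, hq⟩ := exists_exhaustive_tester n hε
    refine ⟨A, n ^ 2, hA, hq, ?_⟩
    push_cast
    have : 1 * x ≤ 140000 * Real.log n ^ 1 * x :=
      mul_le_mul_of_nonneg_right (by linarith) (by linarith)
    linarith
  · -- Here `√n / ε < n²`, so `log m = O(log n)`.
    set m := ⌈64 * √n / ε⌉₊ with hm
    have hm1 : 64 * √n / ε ≤ m := Nat.le_ceil _
    have hm2 : (m : ℝ) ≤ 64 * √n / ε + 1 := (Nat.ceil_lt_add_one (by positivity)).le
    obtain ⟨A, hA, hq⟩ := exists_quicksort_tester hn hε h1 hm1 hm2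
    refine ⟨A, _, hA, hq, ?_⟩
    have hmx : (m : ℝ) ≤ 65 * x := by
      have : 64 * √n / ε = 64 * x := by rw [hx, mul_div_assoc]
      linarith
    have hmpos : (0 : ℝ) < m := lt_of_lt_of_le (by positivity) hm1
    have hlogm : Real.log m ≤ 9 * Real.log n := by
      have h3 : (m : ℝ) ≤ n ^ 9 := by
        have h4 : (2 : ℝ) ^ 7 ≤ n ^ 7 := pow_le_pow_left₀ (by norm_num) hn' 7
        have h5 : (0 : ℝ) ≤ n ^ 2 := by positivity
        calc (m : ℝ) ≤ 65 * n ^ 2 := by linarith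
          _ ≤ n ^ 7 * n ^ 2 := mul_le_mul_of_nonneg_right (by linarith) h5
          _ = n ^ 9 := by ring
      have h6 := Real.log_le_log hmpos h3
      rw [Real.log_pow] at h6
      exact_mod_cast h6
    have h0 : 0 ≤ Real.log m := Real.log_natCast_nonneg m
    have hceil := (Nat.ceil_lt_add_one
      (by positivity : 0 ≤ 30 * (m : ℝ) * (1 + 6 * (1 + Real.log m)))).le
    refine hceil.trans ?_
    have h7 : 30 * (m : ℝ) * (1 + 6 * (1 + Real.log m)) ≤ 30 * (65 * x) * (68 * Real.log n) := by
      refine mul_le_mul (by linarith) (by linarith) (by positivity) (by positivity)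
    have h8 : 1 * 1 ≤ (2 * Real.log n) * x :=
      mul_le_mul (by linarith) hx1 (by norm_num) (by linarith)
    have h9 : 0 ≤ Real.log n * x := mul_nonneg hL (by linarith)
    rw [pow_one]
    linarith

/-! ### The hard instances -/

/-- The position with number `a` in the block `k` of three consecutive positions. -/
def slot (k : Fin (n / 3)) (a : Fin 3) : Fin n := ⟨3 * k + a, by omega⟩

theorem slot_inj {k l : Fin (n / 3)} {a b : Fin 3} (h : slot k a = slot l b) :
    k = l ∧ a = b := by
  have h' : 3 * (k : ℕ) + a = 3 * l + b := congrArg Fin.val h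
  constructor <;> ext <;> omega

/-- The pair of positions in the block `i.1` other than the one numbered `i.2`, relabelled
by `π`. -/
def blockPair (π : Equiv.Perm (Fin n)) (i : Fin (n / 3) × Fin 3) : Pair n :=
  ⟨(Finset.univ.erase i.2).map
    ⟨fun b => π (slot i.1 b), fun _ _ h => (slot_inj (π.injective h)).2⟩, by simp⟩

theorem mem_blockPair {π : Equiv.Perm (Fin n)} {i : Fin (n / 3) × Fin 3} {u : Fin n} :
    u ∈ (blockPair π i).1 ↔ ∃ b, b ≠ i.2 ∧ π (slot i.1 b) = u := by
  simp only [blockPair, Finset.mem_map, Finset.mem_erase, Finset.mem_univ, and_true]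
  rfl

/-- The uniform distribution on the pairs inside the blocks. -/
noncomputable def blockDist [NeZero (n / 3)] (π : Equiv.Perm (Fin n)) : PMF (Pair n) :=
  (PMF.uniformOfFintype (Fin (n / 3) × Fin 3)).map (blockPair π)

open Classical in
theorem weight_blockDist [NeZero (n / 3)] (π : Equiv.Perm (Fin n)) (e : Pair n) :
    weight (blockDist π) e
      = (3 * (n / 3 : ℕ) : ℝ)⁻¹ * ∑ i, if blockPair π i = e then 1 else 0 := by
  have h3 : ((3 : ℝ≥0∞) * ((n / 3 : ℕ) : ℝ≥0∞))⁻¹ ≠ ∞ := by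
    simp [NeZero.ne (n / 3)]
  rw [weight, blockDist, PMF.map_apply, tsum_fintype, ENNReal.toReal_sum, Finset.mul_sum]
  · refine Finset.sum_congr rfl fun i _ => ?_
    by_cases h : blockPair π i = e
    · simp [h, mul_comm]
    · simp [h, Ne.symm h]
  · intro i _
    split_ifs
    · exact PMF.apply_ne_top _ _
    · exact ENNReal.zero_ne_top

theorem sum_weight_blockDist_mul [NeZero (n / 3)] (π : Equiv.Perm (Fin n)) (g : Pair n → ℝ) :
    ∑ e, weight (blockDist π) e * g e
      = (3 * (n / 3 : ℕ) : ℝ)⁻¹ * ∑ i, g (blockPair π i) := by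
  classical
  simp_rw [weight_blockDist, mul_assoc, ← Finset.mul_sum, Finset.sum_mul]
  rw [Finset.sum_comm]
  simp

/-- The total ordering by position, where `π` maps positions to elements. -/
def orderedCmp (π : Equiv.Perm (Fin n)) : Comparison n := rankOrder fun u => (π.symm u : ℕ)

theorem orderedCmp_lt {π : Equiv.Perm (Fin n)} {u v : Fin n} :
    (orderedCmp π).lt u v = true ↔ π.symm u < π.symm v := by
  simp only [orderedCmp, rankOrder, decide_eq_true_eq, Fin.val_fin_lt, Fin.val_inj,
    EmbeddingLike.apply_eq_iff_eq, or_iff_left_iff_imp]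
  rintro ⟨rfl, h⟩
  exact absurd h (lt_irrefl _)

/-- `i` and `j` are the first and the last position of a block. -/
def BlockEnds (i j : Fin n) : Prop := (i : ℕ) % 3 = 0 ∧ (j : ℕ) = i + 2

instance (i j : Fin n) : Decidable (BlockEnds i j) := by unfold BlockEnds; infer_instance

/-- The ordering by position, with the comparison of the first and the last position of each block
reversed, so that every block is a cyclic triangle. -/
def cyclicCmp (π : Equiv.Perm (Fin n)) : Comparison n where
  lt u v := decide ((π.symm u < π.symm v ∧ ¬ BlockEnds (π.symm u) (π.symm v)) ∨
    BlockEnds (π.symm v) (π.symm u))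
  lt_irrefl u := by simp [BlockEnds]
  lt_swap u v h := by
    have h' : (π.symm u : ℕ) ≠ π.symm v := fun h1 => h (π.symm.injective (Fin.ext h1))
    rw [← decide_not]
    refine decide_eq_decide.2 ?_
    unfold BlockEnds
    rw [Fin.lt_def, Fin.lt_def]
    omega

theorem cyclicCmp_lt {π : Equiv.Perm (Fin n)} {u v : Fin n} :
    (cyclicCmp π).lt u v = true ↔ (π.symm u < π.symm v ∧ ¬ BlockEnds (π.symm u) (π.symm v)) ∨
      BlockEnds (π.symm v) (π.symm u) := by
  simp [cyclicCmp]

theorem exists_blockPair_mem_disagreement (π : Equiv.Perm (Fin n)) {τ : Comparison n}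
    (hτ : τ.IsTotal) (k : Fin (n / 3)) :
    ∃ a, blockPair π (k, a) ∈ disagreement (cyclicCmp π) τ := by
  have htr : ∀ {a b c}, τ.lt a b = true → τ.lt b c = true → τ.lt a c = true :=
    fun h1 h2 => hτ.toIsStrictOrder.toIsTrans.trans _ _ _ h1 h2
  have hlt : ∀ a : Fin 3, (cyclicCmp π).lt (π (slot k a)) (π (slot k (a + 1))) = true := by
    intro a
    rw [cyclicCmp_lt]
    fin_cases a <;> simp [BlockEnds, slot, Fin.lt_def]
  by_contra! h
  have hτlt : ∀ a : Fin 3, τ.lt (π (slot k a)) (π (slot k (a + 1))) = true := by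
    intro a
    by_contra h1
    have hne : π (slot k a) ≠ π (slot k (a + 1)) := by
      intro h2
      have := (slot_inj (π.injective h2)).2
      fin_cases a <;> simp at this
    refine h (a + 2) ⟨_, mem_blockPair.2 ⟨a, ?_, rfl⟩, _, mem_blockPair.2 ⟨a + 1, ?_, rfl⟩,
      hlt a, ?_⟩
    · exact (by decide : ∀ a : Fin 3, a ≠ a + 2) a
    · exact (by decide : ∀ a : Fin 3, a + 1 ≠ a + 2) a
    · rw [τ.lt_swap _ _ hne]
      simpa using h1
  have := htr (htr (hτlt 0) (hτlt 1)) (hτlt 2)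
  have h2 : τ.lt (π (slot k 0)) (π (slot k 0)) = true := this
  rw [τ.lt_irrefl] at h2
  cases h2

theorem isFar_cyclicCmp [NeZero (n / 3)] (π : Equiv.Perm (Fin n)) {ε : ℝ} (hε : ε ≤ 1 / 3) :
    IsFar (blockDist π) (cyclicCmp π) ε := by
  classical
  intro τ hτ
  rw [distance_eq]
  refine ENNReal.ofReal_le_ofReal (hε.trans ?_)
  have h1 : ∀ e, (if e ∈ disagreement (cyclicCmp π) τ then weight (blockDist π) e else 0)
      = weight (blockDist π) e * if e ∈ disagreement (cyclicCmp π) τ then 1 else 0 := by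
    intro e
    split_ifs <;> simp
  simp_rw [h1]
  rw [sum_weight_blockDist_mul, Fintype.sum_prod_type]
  have h2 : ∑ k : Fin (n / 3), (1 : ℝ) ≤ ∑ k : Fin (n / 3), ∑ a : Fin 3,
      if blockPair π (k, a) ∈ disagreement (cyclicCmp π) τ then (1 : ℝ) else 0 := by
    refine Finset.sum_le_sum fun k _ => ?_
    obtain ⟨a, ha⟩ := exists_blockPair_mem_disagreement π hτ k
    calc (1 : ℝ) = if blockPair π (k, a) ∈ disagreement (cyclicCmp π) τ then (1 : ℝ) else 0 :=
          (if_pos ha).symm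
      _ ≤ _ := Finset.single_le_sum (f := fun a =>
          if blockPair π (k, a) ∈ disagreement (cyclicCmp π) τ then (1 : ℝ) else 0)
          (fun b _ => by split_ifs <;> norm_num) (Finset.mem_univ a)
  have hm : (0 : ℝ) < (n / 3 : ℕ) := Nat.cast_pos.2 (Nat.pos_of_ne_zero (NeZero.ne _))
  rw [Finset.sum_const, Finset.card_univ, Fintype.card_fin, nsmul_eq_mul, mul_one] at h2
  rw [inv_mul_eq_div, le_div_iff₀ (by positivity)]
  linarith

/-! ### Evaluation of an algorithm along the touched elements -/

namespace Tree

/-- The expectation of `F b T`, where `b` is the answer of the algorithm and `T` is the set of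
elements that it has seen, in queries or in samples, or that belong to the initial set. -/
noncomputable def leafSum (σ : Comparison n) (d : Pair n → ℝ)
    (F : Bool → Finset (Fin n) → ℝ) : Tree n → Finset (Fin n) → ℝ
  | answer b, T => F b T
  | query u v _ next, T => (next (σ.lt u v)).leafSum σ d F (insert u (insert v T))
  | sample next, T => ∑ e, d e * (next e).leafSum σ d F (T ∪ e.1)

theorem leafSum_mono {σ : Comparison n} {d : Pair n → ℝ} (hd : ∀ e, 0 ≤ d e)
    {F G : Bool → Finset (Fin n) → ℝ} (h : ∀ b T, F b T ≤ G b T) (t : Tree n)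
    (T : Finset (Fin n)) : t.leafSum σ d F T ≤ t.leafSum σ d G T := by
  induction t generalizing T with
  | answer b => exact h b T
  | query u v _ next ih => exact ih _ _
  | sample next ih => exact Finset.sum_le_sum fun e _ => mul_le_mul_of_nonneg_left (ih e _) (hd e)

theorem leafSum_add (σ : Comparison n) (d : Pair n → ℝ) (F G : Bool → Finset (Fin n) → ℝ)
    (t : Tree n) (T : Finset (Fin n)) :
    t.leafSum σ d (fun b T => F b T + G b T) T = t.leafSum σ d F T + t.leafSum σ d G T := by
  induction t generalizing T with
  | answer b => rfl
  | query u v _ next ih => exact ih _ _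
  | sample next ih =>
    simp only [leafSum, ih, mul_add, Finset.sum_add_distrib]

theorem leafSum_answer (σ : Comparison n) (d : Pair n → ℝ) (t : Tree n) (T : Finset (Fin n)) :
    t.leafSum σ d (fun b _ => if b then 1 else 0) T = t.acc σ d := by
  induction t generalizing T with
  | answer b => rfl
  | query u v _ next ih => exact ih _ _
  | sample next ih => simp only [leafSum, acc, ih]

end Tree

/-- No block has been seen completely. -/
def NoFullBlock (π : Equiv.Perm (Fin n)) (T : Finset (Fin n)) : Prop :=
  ∀ k, ∃ a, π (slot k a) ∉ T

/-! ### Coupling the two instances -/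

/-- Reverses the blocks in `S`. -/
def blockFlip (S : Finset (Fin (n / 3))) (i : Fin n) : Fin n :=
  if h : (i : ℕ) / 3 < n / 3 then
    if (⟨i / 3, h⟩ : Fin (n / 3)) ∈ S then slot ⟨i / 3, h⟩ (Fin.rev ⟨i % 3, by omega⟩) else i
  else i

theorem slot_div_mod {i : Fin n} (h : (i : ℕ) / 3 < n / 3) :
    slot ⟨i / 3, h⟩ ⟨i % 3, by omega⟩ = i := by
  ext
  simp only [slot]
  omega

theorem blockFlip_slot (S : Finset (Fin (n / 3))) (k : Fin (n / 3)) (a : Fin 3) :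
    blockFlip S (slot k a) = slot k (if k ∈ S then a.rev else a) := by
  have h1 : ((slot k a : Fin n) : ℕ) / 3 = k := by simp only [slot]; omega
  have h2 : ((slot k a : Fin n) : ℕ) % 3 = a := by simp only [slot]; omega
  unfold blockFlip
  simp only [h1, h2, Fin.is_lt, dif_pos, Fin.eta]
  split_ifs <;> rfl

theorem blockFlip_involutive (S : Finset (Fin (n / 3))) :
    Function.Involutive (blockFlip S) := by
  intro i
  by_cases h : (i : ℕ) / 3 < n / 3
  · rw [← slot_div_mod h, blockFlip_slot, blockFlip_slot]
    split_ifs <;> simp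
  · have : blockFlip S i = i := dif_neg h
    rw [this, this]

/-- The blocks in which exactly the first and the last position have been seen. -/
def endsOnly (π : Equiv.Perm (Fin n)) (T : Finset (Fin n)) : Finset (Fin (n / 3)) :=
  Finset.univ.filter fun k => π (slot k 0) ∈ T ∧ π (slot k 1) ∉ T ∧ π (slot k 2) ∈ T

/-- Reverses the blocks in which exactly the first and the last position have been seen. -/
def flipEnds (T : Finset (Fin n)) (π : Equiv.Perm (Fin n)) : Equiv.Perm (Fin n) :=
  π * (blockFlip_involutive (endsOnly π T)).toPerm

theorem flipEnds_slot (T : Finset (Fin n)) (π : Equiv.Perm (Fin n)) (k : Fin (n / 3))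
    (a : Fin 3) :
    flipEnds T π (slot k a) = π (slot k (if k ∈ endsOnly π T then a.rev else a)) :=
  congrArg π (blockFlip_slot _ k a)

theorem flipEnds_symm_apply (T : Finset (Fin n)) (π : Equiv.Perm (Fin n)) (u : Fin n) :
    (flipEnds T π).symm u = blockFlip (endsOnly π T) (π.symm u) := rfl

theorem endsOnly_flipEnds (T : Finset (Fin n)) (π : Equiv.Perm (Fin n)) :
    endsOnly (flipEnds T π) T = endsOnly π T := by
  ext k
  have h0 : Fin.rev (0 : Fin 3) = 2 := rfl
  have h1 : Fin.rev (1 : Fin 3) = 1 := rfl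
  have h2 : Fin.rev (2 : Fin 3) = 0 := rfl
  by_cases hk : k ∈ endsOnly π T
  · have hk' := hk
    simp only [endsOnly, Finset.mem_filter, Finset.mem_univ, true_and] at hk'
    simp only [hk, iff_true]
    rw [endsOnly, Finset.mem_filter]
    simp only [flipEnds_slot, hk, if_true, h0, h1, h2, Finset.mem_univ, true_and]
    tauto
  · rw [endsOnly, Finset.mem_filter]
    simp only [flipEnds_slot, hk, if_false]
    simpa [endsOnly] using hk

theorem flipEnds_involutive (T : Finset (Fin n)) :
    Function.Involutive (flipEnds T) := by
  intro π
  ext i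
  have h : flipEnds T (flipEnds T π) i
      = π (blockFlip (endsOnly π T) (blockFlip (endsOnly (flipEnds T π) T) i)) := rfl
  rw [h, endsOnly_flipEnds, blockFlip_involutive]

theorem noFullBlock_flipEnds {T : Finset (Fin n)} {π : Equiv.Perm (Fin n)} :
    NoFullBlock (flipEnds T π) T ↔ NoFullBlock π T := by
  refine forall_congr' fun k => ?_
  by_cases hk : k ∈ endsOnly π T
  · simp only [flipEnds_slot, hk, if_true]
    exact ⟨fun ⟨a, ha⟩ => ⟨a.rev, ha⟩, fun ⟨a, ha⟩ => ⟨a.rev, by rwa [Fin.rev_rev]⟩⟩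
  · simp only [flipEnds_slot, hk, if_false]

theorem weight_blockDist_flipEnds [NeZero (n / 3)] (T : Finset (Fin n))
    (π : Equiv.Perm (Fin n)) (e : Pair n) :
    weight (blockDist (flipEnds T π)) e = weight (blockDist π) e := by
  classical
  set s : Fin (n / 3) × Fin 3 → Fin (n / 3) × Fin 3 :=
    fun i => (i.1, if i.1 ∈ endsOnly π T then i.2.rev else i.2) with hs
  have hinv : Function.Involutive s := by
    rintro ⟨k, a⟩
    by_cases hk : k ∈ endsOnly π T <;> simp [hs, hk]
  have h1 : ∀ i, blockPair (flipEnds T π) i = blockPair π (s i) := by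
    rintro ⟨k, a⟩
    apply Subtype.ext
    ext u
    rw [mem_blockPair, mem_blockPair]
    by_cases hk : k ∈ endsOnly π T
    · simp only [hs, flipEnds_slot, hk, if_true]
      constructor
      · rintro ⟨b, hb, h⟩
        exact ⟨b.rev, fun h' => hb (Fin.rev_injective h'), h⟩
      · rintro ⟨b, hb, h⟩
        exact ⟨b.rev, fun h' => hb (by rw [← h', Fin.rev_rev]), by rwa [Fin.rev_rev]⟩
    · simp only [hs, flipEnds_slot, hk, if_false]
  rw [weight_blockDist, weight_blockDist]
  simp_rw [h1]
  congr 1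
  exact Equiv.sum_comp hinv.toPerm fun i => if blockPair π i = e then (1 : ℝ) else 0

/-- On the elements seen so far, reversing the blocks of which exactly the two ends have been seen
turns the cyclic instance into the ordered one. -/
theorem orderedCmp_flipEnds {T : Finset (Fin n)} {π : Equiv.Perm (Fin n)} (hT : NoFullBlock π T)
    {u v : Fin n} (hu : u ∈ T) (hv : v ∈ T) :
    (orderedCmp (flipEnds T π)).lt u v = (cyclicCmp π).lt u v := by
  rw [Bool.eq_iff_iff, orderedCmp_lt, cyclicCmp_lt, flipEnds_symm_apply, flipEnds_symm_apply]
  set i := π.symm u with hi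
  set j := π.symm v with hj
  have hiT : π i ∈ T := by rwa [hi, Equiv.apply_symm_apply]
  have hjT : π j ∈ T := by rwa [hj, Equiv.apply_symm_apply]
  set S := endsOnly π T with hS
  have hdiv : ∀ x : Fin n, (blockFlip S x : ℕ) / 3 = x / 3 := by
    intro x
    unfold blockFlip
    split_ifs
    · simp only [slot]; omega
    · rfl
    · rfl
  have hflip : ∀ x : Fin n, ∀ k : Fin (n / 3), (x : ℕ) / 3 = k → k ∈ S →
      (blockFlip S x : ℕ) = 3 * k + (2 - x % 3) := by
    intro x k hk hkS
    have h1 : (x : ℕ) / 3 < n / 3 := by omega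
    have h2 : (⟨x / 3, h1⟩ : Fin (n / 3)) = k := Fin.ext hk
    rw [blockFlip, dif_pos h1, h2, if_pos hkS]
    simp only [slot, Fin.val_rev]
    omega
  have hstay : ∀ x : Fin n, (∀ k : Fin (n / 3), (x : ℕ) / 3 = k → k ∉ S) → blockFlip S x = x := by
    intro x hx
    unfold blockFlip
    split_ifs with h1 h2
    · exact absurd h2 (hx _ rfl)
    · rfl
    · rfl
  -- the two ends of a block, both seen
  have hends : ∀ x y : Fin n, π x ∈ T → π y ∈ T → BlockEnds x y →
      (blockFlip S x : ℕ) = y ∧ (blockFlip S y : ℕ) = x := by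
    intro x y hx hy hxy
    obtain ⟨h1, h2⟩ := hxy
    have hk : (x : ℕ) / 3 < n / 3 := by omega
    set k : Fin (n / 3) := ⟨x / 3, hk⟩ with hkdef
    have hkv : (k : ℕ) = x / 3 := rfl
    have hx0 : slot k 0 = x := by
      ext; simp only [slot, Fin.val_zero]; omega
    have hy2 : slot k 2 = y := by
      ext; simp only [slot, Fin.val_two]; omega
    have hkS : k ∈ S := by
      rw [hS, endsOnly, Finset.mem_filter, hx0, hy2]
      refine ⟨Finset.mem_univ _, hx, fun h3 => ?_, hy⟩
      obtain ⟨a, ha⟩ := hT k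
      fin_cases a
      · exact ha (by simpa [hx0] using hx)
      · exact ha h3
      · exact ha (by simpa [hy2] using hy)
    have h4 := hflip x k rfl hkS
    have h5 := hflip y k (by omega) hkS
    omega
  -- a block whose middle has been seen is not reversed
  have hmid : ∀ x : Fin n, π x ∈ T → (x : ℕ) % 3 = 1 → ∀ k : Fin (n / 3), (x : ℕ) / 3 = k →
      k ∉ S := by
    intro x hx hx1 k hk hkS
    have hx' : slot k 1 = x := by
      ext; simp only [slot, Fin.val_one]; omega
    rw [hS, endsOnly, Finset.mem_filter, hx'] at hkS
    exact hkS.2.2.1 hx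
  rw [Fin.lt_def, Fin.lt_def]
  by_cases h1 : BlockEnds i j
  · obtain ⟨h2, h3⟩ := hends i j hiT hjT h1
    obtain ⟨h4, h5⟩ := h1
    unfold BlockEnds
    omega
  by_cases h2 : BlockEnds j i
  · obtain ⟨h3, h4⟩ := hends j i hjT hiT h2
    simp only [h2, or_true, iff_true]
    have := h2.2
    omega
  simp only [h1, h2, not_false_eq_true, and_true, or_false]
  have hdi := hdiv i
  have hdj := hdiv j
  by_cases hblk : (i : ℕ) / 3 = j / 3
  swap
  · omega
  by_cases hij : i = j
  · rw [hij]; simp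
  have hij' : (i : ℕ) ≠ j := fun h => hij (Fin.ext h)
  have hno : ∀ k : Fin (n / 3), (i : ℕ) / 3 = k → k ∉ S := by
    unfold BlockEnds at h1 h2
    by_cases hi1 : (i : ℕ) % 3 = 1
    · exact hmid i hiT hi1
    · have hj1 : (j : ℕ) % 3 = 1 := by omega
      intro k hk
      exact hmid j hjT hj1 k (by omega)
  rw [hstay i hno, hstay j fun k hk => hno k (by omega)]

open Classical in
/-- As long as no block is seen completely, the cyclic and the ordered instance are
indistinguishable: the involution `flipEnds` matches the executions of the algorithm on the two
instances. The weights `f` and `g` stand for the probability that the execution has come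
to the current node. -/
theorem sum_leafSum_ordered_eq_cyclic [NeZero (n / 3)] (t : Tree n) (T : Finset (Fin n))
    (f g : Equiv.Perm (Fin n) → ℝ)
    (hfg : ∀ T', T ⊆ T' → ∀ π, NoFullBlock π T' → f (flipEnds T' π) = g π) :
    ∑ π, f π * t.leafSum (orderedCmp π) (weight (blockDist π))
        (fun b T => if b = true ∧ NoFullBlock π T then 1 else 0) T
      = ∑ π, g π * t.leafSum (cyclicCmp π) (weight (blockDist π))
        (fun b T => if b = true ∧ NoFullBlock π T then 1 else 0) T := by
  induction t generalizing T f g with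
  | answer b =>
    simp only [Tree.leafSum]
    rw [← Equiv.sum_comp (flipEnds_involutive T).toPerm]
    refine Finset.sum_congr rfl fun π _ => ?_
    rw [Function.Involutive.coe_toPerm]
    simp only [noFullBlock_flipEnds]
    by_cases h : NoFullBlock π T
    · rw [hfg T subset_rfl π h]
    · simp [h]
  | query u v h next ih =>
    simp only [Tree.leafSum]
    set T₁ := insert u (insert v T) with hT₁
    have hsub : T ⊆ T₁ := (Finset.subset_insert _ _).trans (Finset.subset_insert _ _)
    have hsplit : ∀ (c : Bool) (x : ℝ) (G : Bool → ℝ),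
        x * G c = ∑ b, (if c = b then x else 0) * G b := by
      intro c x G
      cases c <;> simp
    have h1 : ∀ (f : Equiv.Perm (Fin n) → ℝ) (cmp : Equiv.Perm (Fin n) → Comparison n),
        ∑ π, f π * (next ((cmp π).lt u v)).leafSum (cmp π) (weight (blockDist π))
          (fun b T => if b = true ∧ NoFullBlock π T then 1 else 0) T₁
        = ∑ b, ∑ π, (if (cmp π).lt u v = b then f π else 0) *
          (next b).leafSum (cmp π) (weight (blockDist π))
          (fun b T => if b = true ∧ NoFullBlock π T then 1 else 0) T₁ := by
      intro f cmp
      rw [Finset.sum_comm]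
      refine Finset.sum_congr rfl fun π _ => ?_
      exact hsplit _ _ fun b => (next b).leafSum (cmp π) (weight (blockDist π))
          (fun b T => if b = true ∧ NoFullBlock π T then 1 else 0) T₁
    rw [h1, h1]
    refine Finset.sum_congr rfl fun b _ => ih b T₁ _ _ ?_
    intro T' hT' π hπ
    rw [hfg T' (hsub.trans hT') π hπ, orderedCmp_flipEnds hπ (hT' (by simp [hT₁]))
      (hT' (by simp [hT₁]))]
  | sample next ih =>
    simp only [Tree.leafSum, Finset.mul_sum, ← mul_assoc]
    rw [Finset.sum_comm, Finset.sum_comm (f := fun π e => g π * _ * _)]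
    refine Finset.sum_congr rfl fun e _ => ih e (T ∪ e.1) _ _ ?_
    intro T' hT' π hπ
    rw [hfg T' (Finset.subset_union_left.trans hT') π hπ, weight_blockDist_flipEnds]

/-! ### Blocks are rarely seen completely -/

/-- `u` has not been seen, but lies in the block of an element that has. -/
def Touches (π : Equiv.Perm (Fin n)) (T : Finset (Fin n)) (u : Fin n) : Prop :=
  u ∉ T ∧ ∃ x ∈ T, (π.symm u : ℕ) / 3 = (π.symm x : ℕ) / 3

open Classical in
/-- Given the positions of the elements in `T`, an element outside `T` is equally likely to be in
each of the other positions, at most `3 |T|` of which are in the blocks of elements of `T`. -/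
theorem sum_touches_le {T : Finset (Fin n)} {f : Equiv.Perm (Fin n) → ℝ} (hf : ∀ π, 0 ≤ f π)
    (hinv : ∀ x ∉ T, ∀ y ∉ T, ∀ π, f (Equiv.swap x y * π) = f π) (u : Fin n) :
    ((n : ℝ) - T.card) * ∑ π, f π * (if Touches π T u then 1 else 0)
      ≤ 3 * T.card * ∑ π, f π := by
  have hcard : (T.card : ℝ) ≤ n := by
    have := Finset.card_le_univ T
    rw [Fintype.card_fin] at this
    exact_mod_cast this
  have hsum0 : 0 ≤ ∑ π, f π := Finset.sum_nonneg fun π _ => hf π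
  by_cases hu : u ∈ T
  · have : ∀ π, ¬ Touches π T u := fun π h => h.1 hu
    simp only [this, if_false, mul_zero, Finset.sum_const_zero]
    positivity
  have h1 : ∀ w ∈ Tᶜ, ∑ π, f π * (if Touches π T w then 1 else 0)
      = ∑ π, f π * (if Touches π T u then (1 : ℝ) else 0) := by
    intro w hw
    rw [Finset.mem_compl] at hw
    rw [← Equiv.sum_comp (Equiv.mulLeft (Equiv.swap u w))]
    refine Finset.sum_congr rfl fun π _ => ?_
    rw [Equiv.coe_mulLeft, hinv u hu w hw]
    congr 1
    have h2 : ∀ x, (Equiv.swap u w * π).symm x = π.symm (Equiv.swap u w x) := fun x => rfl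
    have h3 : Touches (Equiv.swap u w * π) T w ↔ Touches π T u := by
      unfold Touches
      simp only [h2, Equiv.swap_apply_right, hu, hw, not_false_eq_true, true_and]
      refine exists_congr fun x => and_congr_right fun hx => ?_
      rw [Equiv.swap_apply_of_ne_of_ne (x := x) (by rintro rfl; exact hu hx)
        (by rintro rfl; exact hw hx)]
    simp only [h3]
  have h4 : ∑ w ∈ Tᶜ, ∑ π, f π * (if Touches π T w then (1 : ℝ) else 0)
      = ((n : ℝ) - T.card) * ∑ π, f π * (if Touches π T u then 1 else 0) := by
    rw [Finset.sum_congr rfl h1, Finset.sum_const, Finset.card_compl, Fintype.card_fin,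
      nsmul_eq_mul, Nat.cast_sub (by exact_mod_cast hcard)]
  rw [← h4, Finset.sum_comm, Finset.mul_sum]
  refine Finset.sum_le_sum fun π _ => ?_
  rw [← Finset.mul_sum, mul_comm]
  refine mul_le_mul_of_nonneg_right ?_ (hf π)
  rw [Finset.sum_boole]
  have hsub : Tᶜ.filter (fun w => Touches π T w)
      ⊆ T.biUnion fun x => Finset.univ.filter fun w => (π.symm w : ℕ) / 3 = (π.symm x : ℕ) / 3 := by
    intro w hw
    obtain ⟨x, hx, h⟩ := (Finset.mem_filter.1 hw).2.2
    exact Finset.mem_biUnion.2 ⟨x, hx, Finset.mem_filter.2 ⟨Finset.mem_univ _, h⟩⟩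
  have hblock : ∀ x ∈ T, (Finset.univ.filter fun w =>
      (π.symm w : ℕ) / 3 = (π.symm x : ℕ) / 3).card ≤ 3 := by
    intro x _
    have h5 := Finset.card_le_card_of_injOn (s := Finset.univ.filter fun w =>
      (π.symm w : ℕ) / 3 = (π.symm x : ℕ) / 3) (t := Finset.range 3)
      (fun w => (π.symm w : ℕ) % 3)
      (fun w _ => Finset.mem_coe.2 (Finset.mem_range.2 (Nat.mod_lt _ (by norm_num)))) (by
        intro a ha b hb hab
        have ha' := (Finset.mem_filter.1 (Finset.mem_coe.1 ha)).2
        have hb' := (Finset.mem_filter.1 (Finset.mem_coe.1 hb)).2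
        apply π.symm.injective
        ext
        simp only at hab
        omega)
    rwa [Finset.card_range] at h5
  have h6 := (Finset.card_le_card hsub).trans (Finset.card_biUnion_le_card_mul _ _ 3 hblock)
  calc ((Tᶜ.filter fun w => Touches π T w).card : ℝ) ≤ (T.card * 3 : ℕ) := by exact_mod_cast h6
    _ = 3 * T.card := by push_cast; ring

/-- A comparison completes a block only if one of the two elements is new and lies in the block of
an element seen before. -/
theorem noFullBlock_insert {π : Equiv.Perm (Fin n)} {T : Finset (Fin n)} {u v : Fin n}
    (hT : NoFullBlock π T) (hu : ¬ Touches π T u) (hv : ¬ Touches π T v) :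
    NoFullBlock π (insert u (insert v T)) := by
  intro k
  by_contra! h
  have hall : ∀ a, π (slot k a) = u ∨ π (slot k a) = v ∨ π (slot k a) ∈ T := by
    intro a
    simpa using h a
  have hinj : ∀ a b, π (slot k a) = π (slot k b) → a = b :=
    fun a b h => (slot_inj (π.injective h)).2
  have hdiv : ∀ a : Fin 3, ((slot k a : Fin n) : ℕ) / 3 = k := by
    intro a; simp only [slot]; omega
  have htouch : ∀ a b, π (slot k a) ∉ T → π (slot k b) ∈ T → Touches π T (π (slot k a)) := by
    intro a b ha hb
    refine ⟨ha, _, hb, ?_⟩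
    rw [Equiv.symm_apply_apply, Equiv.symm_apply_apply, hdiv, hdiv]
  have hsome : ∃ b, π (slot k b) ∈ T := by
    by_contra! hno
    have h2 : ∀ a, π (slot k a) = u ∨ π (slot k a) = v := fun a =>
      (hall a).imp_right fun h => h.resolve_right (hno a)
    rcases h2 0 with h0 | h0 <;> rcases h2 1 with h1 | h1 <;> rcases h2 2 with h2 | h2 <;>
      first
        | exact absurd (hinj 0 1 (h0.trans h1.symm)) (by decide)
        | exact absurd (hinj 0 2 (h0.trans h2.symm)) (by decide)
        | exact absurd (hinj 1 2 (h1.trans h2.symm)) (by decide)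
  obtain ⟨b, hb⟩ := hsome
  obtain ⟨a, ha⟩ := hT k
  rcases hall a with h1 | h1 | h1
  · exact hu (h1 ▸ htouch a b ha hb)
  · exact hv (h1 ▸ htouch a b ha hb)
  · exact ha h1

/-- A sample completes a block only if the third element of its block has been seen before. -/
theorem noFullBlock_union {π : Equiv.Perm (Fin n)} {T : Finset (Fin n)}
    {i : Fin (n / 3) × Fin 3} (hT : NoFullBlock π T) (hi : π (slot i.1 i.2) ∉ T) :
    NoFullBlock π (T ∪ (blockPair π i).1) := by
  intro k
  obtain ⟨a, ha⟩ := hT k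
  by_cases hk : k = i.1
  · subst hk
    refine ⟨i.2, fun h => ?_⟩
    rcases Finset.mem_union.1 h with h | h
    · exact hi h
    · obtain ⟨b, hb, h'⟩ := mem_blockPair.1 h
      exact hb (slot_inj (π.injective h')).2
  · refine ⟨a, fun h => ?_⟩
    rcases Finset.mem_union.1 h with h | h
    · exact ha h
    · obtain ⟨b, hb, h'⟩ := mem_blockPair.1 h
      exact hk (slot_inj (π.injective h')).1.symm

open Classical in
theorem sum_weight_not_noFullBlock_le [NeZero (n / 3)] (π : Equiv.Perm (Fin n))
    (T : Finset (Fin n)) :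
    ∑ e, weight (blockDist π) e * (if NoFullBlock π (T ∪ e.1) then 0 else 1)
      ≤ (if NoFullBlock π T then 0 else 1) + T.card / (3 * (n / 3 : ℕ)) := by
  have hm : (0 : ℝ) < (n / 3 : ℕ) := Nat.cast_pos.2 (Nat.pos_of_ne_zero (NeZero.ne _))
  have hm3 : (0 : ℝ) < 3 * (n / 3 : ℕ) := by positivity
  by_cases hT : NoFullBlock π T
  · rw [if_pos hT, zero_add, sum_weight_blockDist_mul, inv_mul_eq_div]
    refine div_le_div_of_nonneg_right ?_ hm3.le
    calc ∑ i, (if NoFullBlock π (T ∪ (blockPair π i).1) then (0 : ℝ) else 1)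
        ≤ ∑ i : Fin (n / 3) × Fin 3, if π (slot i.1 i.2) ∈ T then (1 : ℝ) else 0 := by
          refine Finset.sum_le_sum fun i _ => ?_
          by_cases hi : π (slot i.1 i.2) ∈ T
          · rw [if_pos hi]
            split_ifs <;> norm_num
          · rw [if_pos (noFullBlock_union hT hi), if_neg hi]
      _ = ((Finset.univ.filter fun i : Fin (n / 3) × Fin 3 => π (slot i.1 i.2) ∈ T).card : ℝ) :=
          Finset.sum_boole _ _
      _ ≤ T.card := by
          have := Finset.card_le_card_of_injOn (s := Finset.univ.filter
            fun i : Fin (n / 3) × Fin 3 => π (slot i.1 i.2) ∈ T) (t := T)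
            (fun i => π (slot i.1 i.2))
            (fun i hi => Finset.mem_coe.2 (Finset.mem_filter.1 (Finset.mem_coe.1 hi)).2) (by
              intro i _ j _ hij
              obtain ⟨h1, h2⟩ := slot_inj (π.injective hij)
              exact Prod.ext h1 h2)
          exact_mod_cast this
  · rw [if_neg hT]
    have h1 : ∑ e, weight (blockDist π) e * (if NoFullBlock π (T ∪ e.1) then (0 : ℝ) else 1)
        ≤ ∑ e, weight (blockDist π) e := by
      refine Finset.sum_le_sum fun e _ => mul_le_of_le_one_right (weight_nonneg _ e) ?_
      split_ifs <;> norm_num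
    rw [sum_weight] at h1
    have : (0 : ℝ) ≤ T.card / (3 * (n / 3 : ℕ)) := by positivity
    linarith

theorem weight_blockDist_swap [NeZero (n / 3)] (π : Equiv.Perm (Fin n)) {e : Pair n}
    {x y : Fin n} (hx : x ∉ e.1) (hy : y ∉ e.1) :
    weight (blockDist (Equiv.swap x y * π)) e = weight (blockDist π) e := by
  classical
  have hfix : ∀ u ∈ e.1, Equiv.swap x y u = u := fun u hu =>
    Equiv.swap_apply_of_ne_of_ne (fun h => hx (h ▸ hu)) (fun h => hy (h ▸ hu))
  have key : ∀ (ρ : Equiv.Perm (Fin n)) (i), blockPair ρ i = e →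
      blockPair (Equiv.swap x y * ρ) i = e := by
    intro ρ i h
    subst h
    apply Subtype.ext
    ext u
    rw [mem_blockPair, mem_blockPair]
    refine exists_congr fun b => and_congr_right fun hb => ?_
    rw [Equiv.Perm.mul_apply, hfix _ (mem_blockPair.2 ⟨b, hb, rfl⟩)]
  have h1 : ∀ i, blockPair (Equiv.swap x y * π) i = e ↔ blockPair π i = e := by
    refine fun i => ⟨fun h => ?_, key π i⟩
    have := key _ i h
    rwa [← mul_assoc, Equiv.swap_mul_self, one_mul] at this
  rw [weight_blockDist, weight_blockDist]
  simp only [h1]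

theorem orderedCmp_swap (π : Equiv.Perm (Fin n)) {x y u v : Fin n} (hxu : x ≠ u) (hyu : y ≠ u)
    (hxv : x ≠ v) (hyv : y ≠ v) :
    (orderedCmp (Equiv.swap x y * π)).lt u v = (orderedCmp π).lt u v := by
  have h2 : ∀ z, (Equiv.swap x y * π).symm z = π.symm (Equiv.swap x y z) := fun z => rfl
  rw [Bool.eq_iff_iff, orderedCmp_lt, orderedCmp_lt, h2, h2,
    Equiv.swap_apply_of_ne_of_ne hxu.symm hyu.symm, Equiv.swap_apply_of_ne_of_ne hxv.symm hyv.symm]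

open Classical in
/-- The probability that an algorithm sees a complete block of the ordered instance grows by at
most `12 N / n` per step, if at most `N` elements are seen. The weight `f` stands for the
probability that the execution has come to the current node; it depends only on the
positions of the elements seen. -/
theorem sum_leafSum_not_noFullBlock_le [NeZero (n / 3)] {N : ℕ} (hN : 2 * N ≤ n) (t : Tree n)
    (T : Finset (Fin n)) (hT : T.card + 2 * t.cost ≤ N) (f : Equiv.Perm (Fin n) → ℝ)
    (hf : ∀ π, 0 ≤ f π) (hinv : ∀ x ∉ T, ∀ y ∉ T, ∀ π, f (Equiv.swap x y * π) = f π) :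
    ∑ π, f π * t.leafSum (orderedCmp π) (weight (blockDist π))
        (fun _ T => if NoFullBlock π T then 0 else 1) T
      ≤ ∑ π, f π * (if NoFullBlock π T then 0 else 1) + t.cost * (12 * N / n) * ∑ π, f π := by
  have hn0 : n ≠ 0 := by
    rintro rfl
    exact NeZero.ne (0 / 3) rfl
  have hnpos : (0 : ℝ) < n := Nat.cast_pos.2 (Nat.pos_of_ne_zero hn0)
  have hN' : 2 * (N : ℝ) ≤ n := by exact_mod_cast hN
  set δ : ℝ := 12 * N / n with hδ
  have hδ0 : 0 ≤ δ := by positivity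
  induction t generalizing T f with
  | answer b => simp [Tree.leafSum, Tree.cost]
  | query u v h next ih =>
    set T₁ := insert u (insert v T) with hT₁
    have hcost : (Tree.query u v h next).cost = 1 + max (next true).cost (next false).cost := rfl
    have hcostb : ∀ b, (next b).cost ≤ max (next true).cost (next false).cost := by
      intro b; cases b
      · exact le_max_right _ _
      · exact le_max_left _ _
    set M := max (next true).cost (next false).cost with hM
    have hcard₁ : T₁.card ≤ T.card + 2 := by
      have h1 := Finset.card_insert_le u (insert v T)
      have h2 := Finset.card_insert_le v T
      rw [hT₁]
      omega
    have hTN : (T.card : ℝ) ≤ N := by exact_mod_cast (by omega : T.card ≤ N)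
    have hsum0 : 0 ≤ ∑ π, f π := Finset.sum_nonneg fun π _ => hf π
    simp only [Tree.leafSum]
    set fb : Bool → Equiv.Perm (Fin n) → ℝ :=
      fun b π => if (orderedCmp π).lt u v = b then f π else 0 with hfb
    have hfbsum : ∀ π, ∑ b, fb b π = f π := by
      intro π
      simp [hfb]
    have h1 : ∑ π, f π * (next ((orderedCmp π).lt u v)).leafSum (orderedCmp π)
          (weight (blockDist π)) (fun _ T => if NoFullBlock π T then 0 else 1) T₁
        = ∑ b, ∑ π, fb b π * (next b).leafSum (orderedCmp π) (weight (blockDist π))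
          (fun _ T => if NoFullBlock π T then 0 else 1) T₁ := by
      rw [Finset.sum_comm]
      refine Finset.sum_congr rfl fun π _ => ?_
      simp only [hfb]
      cases (orderedCmp π).lt u v <;> simp
    have h2 : ∀ b, ∑ π, fb b π * (next b).leafSum (orderedCmp π) (weight (blockDist π))
          (fun _ T => if NoFullBlock π T then 0 else 1) T₁
        ≤ ∑ π, fb b π * (if NoFullBlock π T₁ then 0 else 1) + M * δ * ∑ π, fb b π := by
      intro b
      have hfb0 : ∀ π, 0 ≤ fb b π := by
        intro π
        simp only [hfb]
        split_ifs
        · exact hf π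
        · exact le_rfl
      have h3 := ih b T₁ (by have := hcostb b; omega) (fb b) hfb0 (by
        intro x hx y hy π
        simp only [hT₁, Finset.mem_insert, not_or] at hx hy
        simp only [hfb]
        rw [orderedCmp_swap π hx.1 hy.1 hx.2.1 hy.2.1, hinv x hx.2.2 y hy.2.2])
      have h4 : ((next b).cost : ℝ) * δ * ∑ π, fb b π ≤ M * δ * ∑ π, fb b π := by
        refine mul_le_mul_of_nonneg_right (mul_le_mul_of_nonneg_right ?_ hδ0)
          (Finset.sum_nonneg fun π _ => hfb0 π)
        exact_mod_cast hcostb b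
      linarith
    have h5 : ∑ b, (∑ π, fb b π * (if NoFullBlock π T₁ then 0 else 1) + M * δ * ∑ π, fb b π)
        = ∑ π, f π * (if NoFullBlock π T₁ then 0 else 1) + M * δ * ∑ π, f π := by
      have hg : ∀ g : Equiv.Perm (Fin n) → ℝ, ∑ b, ∑ π, fb b π * g π = ∑ π, f π * g π := by
        intro g
        rw [Finset.sum_comm]
        exact Finset.sum_congr rfl fun π _ => by rw [← Finset.sum_mul, hfbsum]
      have hg1 := hg fun _ => 1
      simp only [mul_one] at hg1
      rw [Finset.sum_add_distrib, hg, ← Finset.mul_sum, hg1]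
    have htouch : ∀ w, ∑ π, f π * (if Touches π T w then 1 else 0) ≤ δ / 2 * ∑ π, f π := by
      intro w
      have h6 := sum_touches_le hf hinv w
      set X := ∑ π, f π * (if Touches π T w then (1 : ℝ) else 0) with hX
      have hX0 : 0 ≤ X := Finset.sum_nonneg fun π _ => mul_nonneg (hf π) (by
        split_ifs <;> norm_num)
      have h7 : (n : ℝ) / 2 * X ≤ 3 * N * ∑ π, f π := by
        calc (n : ℝ) / 2 * X ≤ (n - T.card) * X :=
              mul_le_mul_of_nonneg_right (by linarith) hX0
          _ ≤ _ := h6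
          _ ≤ _ := mul_le_mul_of_nonneg_right (by linarith) hsum0
      have h8 : δ / 2 * ∑ π, f π = (3 * N * ∑ π, f π) / (n / 2) := by
        rw [hδ]; field_simp; ring
      rw [h8, le_div_iff₀ (by positivity)]
      linarith
    have h6 : ∑ π, f π * (if NoFullBlock π T₁ then 0 else 1)
        ≤ ∑ π, f π * (if NoFullBlock π T then 0 else 1) + δ * ∑ π, f π := by
      have h7 : ∀ π, f π * (if NoFullBlock π T₁ then 0 else 1)
          ≤ f π * (if NoFullBlock π T then 0 else 1)
            + (f π * (if Touches π T u then 1 else 0) + f π * (if Touches π T v then 1 else 0)) := by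
        intro π
        rw [← mul_add, ← mul_add]
        refine mul_le_mul_of_nonneg_left ?_ (hf π)
        by_cases a1 : NoFullBlock π T <;> by_cases a2 : Touches π T u <;>
          by_cases a3 : Touches π T v <;> by_cases a4 : NoFullBlock π T₁ <;>
          simp only [a1, a2, a3, a4, if_true, if_false] <;> norm_num
        exact a4 (noFullBlock_insert a1 a2 a3)
      have h8 := Finset.sum_le_sum fun π (_ : π ∈ Finset.univ) => h7 π
      rw [Finset.sum_add_distrib, Finset.sum_add_distrib] at h8
      have := htouch u
      have := htouch v
      linarith
    rw [h1, hcost]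
    have h9 := Finset.sum_le_sum fun b (_ : b ∈ Finset.univ) => h2 b
    rw [h5] at h9
    push_cast
    linarith
  | sample next ih =>
    have hcost : (Tree.sample next).cost = 1 + Finset.univ.sup fun e => (next e).cost := rfl
    have hcoste : ∀ e, (next e).cost ≤ Finset.univ.sup fun e => (next e).cost := fun e =>
      Finset.le_sup (f := fun e => (next e).cost) (Finset.mem_univ e)
    set M := Finset.univ.sup fun e => (next e).cost with hM
    have hTN : (T.card : ℝ) ≤ N := by exact_mod_cast (by omega : T.card ≤ N)
    have hsum0 : 0 ≤ ∑ π, f π := Finset.sum_nonneg fun π _ => hf π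
    simp only [Tree.leafSum]
    have h0 : ∑ π, f π * ∑ e, weight (blockDist π) e *
          (next e).leafSum (orderedCmp π) (weight (blockDist π))
          (fun _ T => if NoFullBlock π T then 0 else 1) (T ∪ e.1)
        = ∑ e, ∑ π, f π * weight (blockDist π) e *
          (next e).leafSum (orderedCmp π) (weight (blockDist π))
          (fun _ T => if NoFullBlock π T then 0 else 1) (T ∪ e.1) := by
      simp only [Finset.mul_sum, ← mul_assoc]
      rw [Finset.sum_comm]
    have h1 : ∀ e, ∑ π, f π * weight (blockDist π) e *
          (next e).leafSum (orderedCmp π) (weight (blockDist π))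
          (fun _ T => if NoFullBlock π T then 0 else 1) (T ∪ e.1)
        ≤ ∑ π, f π * weight (blockDist π) e * (if NoFullBlock π (T ∪ e.1) then 0 else 1)
          + M * δ * ∑ π, f π * weight (blockDist π) e := by
      intro e
      have hfe : ∀ π, 0 ≤ f π * weight (blockDist π) e := fun π =>
        mul_nonneg (hf π) (weight_nonneg _ e)
      have hcard₁ : (T ∪ e.1).card ≤ T.card + 2 := by
        have := Finset.card_union_le T e.1
        rwa [e.2] at this
      have h3 := ih e (T ∪ e.1) (by have := hcoste e; omega) _ hfe (by
        intro x hx y hy π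
        rw [Finset.mem_union, not_or] at hx hy
        rw [hinv x hx.1 y hy.1, weight_blockDist_swap π hx.2 hy.2])
      have h4 : ((next e).cost : ℝ) * δ * ∑ π, f π * weight (blockDist π) e
          ≤ M * δ * ∑ π, f π * weight (blockDist π) e := by
        refine mul_le_mul_of_nonneg_right (mul_le_mul_of_nonneg_right ?_ hδ0)
          (Finset.sum_nonneg fun π _ => hfe π)
        exact_mod_cast hcoste e
      linarith
    have h2 := Finset.sum_le_sum fun e (_ : e ∈ Finset.univ) => h1 e
    have h3 : ∑ e, (∑ π, f π * weight (blockDist π) e *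
          (if NoFullBlock π (T ∪ e.1) then 0 else 1) + M * δ * ∑ π, f π * weight (blockDist π) e)
        = ∑ π, f π * (∑ e, weight (blockDist π) e *
          (if NoFullBlock π (T ∪ e.1) then 0 else 1)) + M * δ * ∑ π, f π := by
      rw [Finset.sum_add_distrib, Finset.sum_comm, ← Finset.mul_sum,
        Finset.sum_comm (f := fun e π => f π * weight (blockDist π) e)]
      simp_rw [mul_assoc, ← Finset.mul_sum, sum_weight, mul_one]
    have h4 : (T.card : ℝ) / (3 * (n / 3 : ℕ)) ≤ δ := by
      have h5 : (n : ℝ) ≤ 12 * (3 * (n / 3 : ℕ)) := by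
        have h0 := NeZero.ne (n / 3)
        exact_mod_cast (by omega : n ≤ 12 * (3 * (n / 3)))
      have hm3 : (0 : ℝ) < 3 * (n / 3 : ℕ) := by linarith
      rw [hδ, div_le_div_iff₀ hm3 hnpos]
      have h6 : (T.card : ℝ) * n ≤ N * (12 * (3 * (n / 3 : ℕ))) :=
        mul_le_mul hTN h5 hnpos.le (Nat.cast_nonneg N)
      linarith
    have h5 : ∑ π, f π * (∑ e, weight (blockDist π) e *
          (if NoFullBlock π (T ∪ e.1) then 0 else 1))
        ≤ ∑ π, (f π * (if NoFullBlock π T then 0 else 1) + δ * f π) := by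
      refine Finset.sum_le_sum fun π _ => ?_
      rw [mul_comm δ, ← mul_add]
      exact mul_le_mul_of_nonneg_left
        ((sum_weight_not_noFullBlock_le π T).trans (by linarith)) (hf π)
    rw [Finset.sum_add_distrib, ← Finset.mul_sum] at h5
    rw [h3] at h2
    rw [h0, hcost]
    push_cast
    linarith

/-! ### The lower bound -/

theorem sum_acc_ordered_le [NeZero (n / 3)] {q : ℕ} (hq : 4 * q ≤ n) {t : Tree n}
    (ht : t.cost ≤ q) :
    ∑ π, t.acc (orderedCmp π) (weight (blockDist π))
      ≤ ∑ π, t.acc (cyclicCmp π) (weight (blockDist π))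
        + (n.factorial : ℝ) * (24 * q ^ 2 / n) := by
  classical
  have hempty : ∀ π : Equiv.Perm (Fin n), NoFullBlock π ∅ := fun π k => ⟨0, by simp⟩
  have h1 := sum_leafSum_ordered_eq_cyclic t ∅ (fun _ => 1) (fun _ => 1) fun _ _ _ _ => rfl
  have h2 := sum_leafSum_not_noFullBlock_le (N := 2 * q) (by omega) t ∅
    (by rw [Finset.card_empty]; omega) (fun _ => 1) (fun _ => zero_le_one) fun _ _ _ _ _ => rfl
  simp only [one_mul, hempty, if_true, Finset.sum_const_zero, zero_add] at h1 h2
  rw [Finset.sum_const, Finset.card_univ, Fintype.card_perm, Fintype.card_fin, nsmul_eq_mul,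
    mul_one] at h2
  have h3 : ∀ π, t.acc (orderedCmp π) (weight (blockDist π))
      ≤ t.leafSum (orderedCmp π) (weight (blockDist π))
          (fun b T => if b = true ∧ NoFullBlock π T then 1 else 0) ∅
        + t.leafSum (orderedCmp π) (weight (blockDist π))
          (fun _ T => if NoFullBlock π T then 0 else 1) ∅ := by
    intro π
    rw [← Tree.leafSum_add, ← Tree.leafSum_answer _ _ t ∅]
    refine Tree.leafSum_mono (weight_nonneg _) (fun b T => ?_) t ∅
    by_cases h : NoFullBlock π T <;> cases b <;> simp [h]
  have h4 : ∀ π, t.leafSum (cyclicCmp π) (weight (blockDist π))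
      (fun b T => if b = true ∧ NoFullBlock π T then 1 else 0) ∅
      ≤ t.acc (cyclicCmp π) (weight (blockDist π)) := by
    intro π
    rw [← Tree.leafSum_answer _ _ t ∅]
    refine Tree.leafSum_mono (weight_nonneg _) (fun b T => ?_) t ∅
    by_cases h : NoFullBlock π T <;> cases b <;> simp [h]
  have h5 := Finset.sum_le_sum fun π (_ : π ∈ Finset.univ) => h3 π
  have h6 := Finset.sum_le_sum fun π (_ : π ∈ Finset.univ) => h4 π
  rw [Finset.sum_add_distrib] at h5
  have h7 : (t.cost : ℝ) * (12 * (2 * q : ℕ) / n) * n.factorial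
      ≤ n.factorial * (24 * q ^ 2 / n) := by
    have h8 : (t.cost : ℝ) ≤ q := by exact_mod_cast ht
    calc (t.cost : ℝ) * (12 * (2 * q : ℕ) / n) * n.factorial
        ≤ q * (12 * (2 * q : ℕ) / n) * n.factorial := by gcongr
      _ = _ := by push_cast; ring
  linarith

theorem run_true_eq_tsum (A : Algorithm n) (σ : Comparison n) (D : PMF (Pair n)) :
    A.run σ D true = ∑' t, A t * ENNReal.ofReal (t.acc σ (weight D)) := by
  simp_rw [Algorithm.run, PMF.bind_apply, Tree.run_true]

/-- On average over `π`, a tester accepts the ordered instance with probability at least `2 / 3`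
and the cyclic one with probability at most `1 / 3`; it must have seen a complete block to tell
them apart. -/
theorem one_third_le_of_isTester [NeZero (n / 3)] {ε : ℝ} (hε : ε ≤ 1 / 3) {A : Algorithm n} {q : ℕ}
    (hA : A.IsTester ε) (hq : A.QueriesLE q) (hqn : 4 * q ≤ n) :
    (1 : ℝ) / 3 ≤ 24 * q ^ 2 / n := by
  set x : ℝ := 24 * q ^ 2 / n with hx
  have hx0 : 0 ≤ x := by positivity
  have hsum : ∀ (cmp : Equiv.Perm (Fin n) → Comparison n),
      ∑ π, A.run (cmp π) (blockDist π) true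
        = ∑' t, A t * ENNReal.ofReal (∑ π, t.acc (cmp π) (weight (blockDist π))) := by
    intro cmp
    simp_rw [run_true_eq_tsum]
    rw [← Summable.tsum_finsetSum fun _ _ => ENNReal.summable]
    refine tsum_congr fun t => ?_
    rw [← Finset.mul_sum, ENNReal.ofReal_sum_of_nonneg fun π _ =>
      Tree.acc_nonneg (weight_nonneg _) t]
  have h1 : ∑ π, A.run (orderedCmp π) (blockDist π) true
      ≤ ∑ π, A.run (cyclicCmp π) (blockDist π) true
        + ENNReal.ofReal (n.factorial * x) := by
    rw [hsum, hsum]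
    calc ∑' t, A t * ENNReal.ofReal (∑ π, t.acc (orderedCmp π) (weight (blockDist π)))
        ≤ ∑' t, (A t * ENNReal.ofReal (∑ π, t.acc (cyclicCmp π) (weight (blockDist π)))
            + A t * ENNReal.ofReal (n.factorial * x)) := by
          refine ENNReal.tsum_le_tsum fun t => ?_
          by_cases ht : A t = 0
          · simp [ht]
          · rw [← mul_add, ← ENNReal.ofReal_add (Finset.sum_nonneg fun π _ =>
              Tree.acc_nonneg (weight_nonneg _) t) (by positivity)]
            gcongr
            exact sum_acc_ordered_le hqn (hq t ((PMF.mem_support_iff A t).2 ht))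
      _ = _ := by
          rw [ENNReal.tsum_add, ENNReal.tsum_mul_right, A.tsum_coe, one_mul]
  have h2 : ∀ π, (2 / 3 : ℝ) ≤ (A.run (orderedCmp π) (blockDist π) true).toReal := by
    intro π
    have h3 := (hA (orderedCmp π) (blockDist π)).1 (rankOrder_isTotal _)
    have h4 := ENNReal.toReal_mono (PMF.apply_ne_top _ _) h3
    simpa using h4
  have h3 : ∀ π, (A.run (cyclicCmp π) (blockDist π) true).toReal ≤ 1 / 3 := by
    intro π
    have h3 := (hA (cyclicCmp π) (blockDist π)).2 (isFar_cyclicCmp π hε)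
    have h4 := ENNReal.toReal_mono (PMF.apply_ne_top _ _) h3
    have h5 := (A.run (cyclicCmp π) (blockDist π)).tsum_coe
    rw [tsum_bool] at h5
    have h6 := congrArg ENNReal.toReal h5
    rw [ENNReal.toReal_add (PMF.apply_ne_top _ _) (PMF.apply_ne_top _ _)] at h6
    simp at h4 h6
    linarith
  have h4 := ENNReal.toReal_mono (ENNReal.add_ne_top.2
    ⟨ENNReal.sum_ne_top.2 fun π _ => PMF.apply_ne_top _ _, ENNReal.ofReal_ne_top⟩) h1
  rw [ENNReal.toReal_add (ENNReal.sum_ne_top.2 fun π _ => PMF.apply_ne_top _ _)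
    ENNReal.ofReal_ne_top, ENNReal.toReal_sum fun π _ => PMF.apply_ne_top _ _,
    ENNReal.toReal_sum fun π _ => PMF.apply_ne_top _ _,
    ENNReal.toReal_ofReal (by positivity)] at h4
  have h5 := Finset.sum_le_sum fun π (_ : π ∈ Finset.univ) => h2 π
  have h6 := Finset.sum_le_sum fun π (_ : π ∈ Finset.univ) => h3 π
  rw [Finset.sum_const, Finset.card_univ, Fintype.card_perm, Fintype.card_fin,
    nsmul_eq_mul] at h5 h6
  have hfac : (0 : ℝ) < n.factorial := by exact_mod_cast n.factorial_pos
  refine le_of_mul_le_mul_left ?_ hfac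
  linarith

theorem sqrt_le_of_isTester (hn : 3 ≤ n) {ε : ℝ} (hε : ε ≤ 1 / 3) {A : Algorithm n} {q : ℕ}
    (hA : A.IsTester ε) (hq : A.QueriesLE q) : 1 / 9 * √n ≤ q := by
  have : NeZero (n / 3) := ⟨by omega⟩
  have hn' : (3 : ℝ) ≤ n := by exact_mod_cast hn
  have hsq : √(n : ℝ) ^ 2 = n := Real.sq_sqrt (by linarith)
  have hs0 : 0 ≤ √(n : ℝ) := Real.sqrt_nonneg _
  rcases le_or_gt (4 * q) n with h | h
  · have h1 := one_third_le_of_isTester hε hA hq h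
    rw [div_le_div_iff₀ (by norm_num) (by linarith)] at h1
    refine le_of_sq_le_sq ?_ (Nat.cast_nonneg q)
    nlinarith
  · have h1 : (n : ℝ) < 4 * q := by exact_mod_cast h
    have h2 : 1 ≤ √(n : ℝ) := Real.one_le_sqrt.2 (by linarith)
    nlinarith

end TotalOrderTesting

theorem theorem4 :
    (∃ (C : ℝ) (k : ℕ), ∀ (n : ℕ), 2 ≤ n → ∀ (ε : ℝ), 0 < ε →
      ∃ (A : Algorithm n) (q : ℕ), A.IsTester ε ∧ A.QueriesLE q ∧
        (q : ℝ) ≤ C * (Real.log n) ^ k * (Real.sqrt n / ε)) ∧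
    (∃ (ε₀ : ℝ) (c : ℝ), 0 < ε₀ ∧ 0 < c ∧ ∀ (ε : ℝ), 0 < ε → ε ≤ ε₀ →
      ∀ (n : ℕ), 3 ≤ n → ∀ (A : Algorithm n) (q : ℕ), A.IsTester ε → A.QueriesLE q →
        c * Real.sqrt n ≤ (q : ℝ)) := by
  refine ⟨⟨140000, 1, fun n hn ε hε => exists_tester_le hn hε⟩,
    ⟨1 / 3, 1 / 9, by norm_num, by norm_num, fun ε _ hε n hn A q hA hq =>
      sqrt_le_of_isTester hn hε hA hq⟩⟩
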